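/- Let $\mathbb{K}$ be a field of characteristic zero, let $R$ be a commutative unitary $\mathbb{K}$-algebra, and let $\mathfrak{h}=\mathbb{K}\langle x,y\rangle$, $\mathfrak{h}^1=\mathbb{K}+\mathfrak{h}y$, $\mathfrak{h}^0=\mathbb{K}+x\mathfrak{h}y$ and $z_k=x^{k-1}y$ for $k\ge 1$. The shuffle product ⧢ on $\mathfrak{h}$ is the $\mathbb{K}$-bilinear product with $w$⧢$1=1$⧢$w=w$ and $au$⧢$bv=a(u$⧢$bv)+b(au$⧢$v)$ for words $u,v,w$ and letters $a,b$. The stuffle product $\ast$ on $\mathfrak{h}^1$ is the $\mathbb{K}$-bilinear product with $w\ast 1=1\ast w=w$ and $z_ku\ast z_lv=z_k(u\ast z_lv)+z_l(z_ku\ast v)+z_{k+l}(u\ast v)$ for words $u,v,w$ of $\mathfrak{h}^1$ and $k,l\ge 1$. Every $w\in\mathfrak{h}^1$ is uniquely a finite sum $w=\sum_{i\ge 0} w_i$⧢$y^{i}$ with $w_i\in\mathfrak{h}^0$, where $y^{i}$ here denotes the $i$-th shuffle power of $y$; put $\mathrm{reg}(w)=w_0$. A $\mathbb{K}$-linear map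 $Z_R:\mathfrak{h}^0\to R$ satisfies the regularized double shuffle relations if $Z_R(1)=1$, $Z_R(u$⧢$v)=Z_R(u)Z_R(v)=Z_R(u\ast v)$ for all $u,v\in\mathfrak{h}^0$, and $Z_R(\mathrm{reg}(w_1$⧢$w_0-w_1\ast w_0))=0$ for all $w_1\in\mathfrak{h}^1$, $w_0\in\mathfrak{h}^0$. For an index $(k_1,\dots,k_r)$ of positive integers that is empty or has $k_1\ge 2$, put $\zeta_R(k_1,\dots,k_r)=Z_R(z_{k_1}\cdots z_{k_r})$ and $\zeta_R^\star(k_1,\dots,k_r)=Z_R(S(z_{k_1}\cdots z_{k_r}))$. Here $S$ is the $\mathbb{K}$-linear map on $\mathfrak{h}$ with $S(1)=1$ and $S(wa)=\sigma(w)a$ for words $w$ and letters $a$, where $\sigma$ is the algebra endomorphism of $\mathfrak{h}$ with $\sigma(x)=x$, $\sigma(y)=x+y$. The symbol $\{m\}^n$ means $m$ repeated $n$ times. Let $B_n$ be the Bernoulli numbers, $\sum_{n\ge 0} B_nt^n/n!=t/(e^t-1)$, and $\rho_k=e^{\pi i/k}$. **Theorem.** Let $Z_R:\mathfrak{h}^0\to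 R$ satisfy the regularized double shuffle relations, and let $\lambda$ be an element of a commutative $R$-algebra $L$ (for example $L=R$ or an extension ring of $R$) with $\lambda^2=-24\,\zeta_R(2)$ in $L$. Then for every integer $k\ge 1$ and every integer $n\ge 0$ the complex numbers $$c_{k,n}=(-1)^n\sum_{\substack{n_0+\dots+n_{k-1}=nk\\ n_0,\dots,n_{k-1}\ge 0}}\frac{\rho_k^{\sum_{j=0}^{k-1}2jn_j}}{(2n_0+1)!\cdots(2n_{k-1}+1)!},$$ $$c^\star_{k,n}=\sum_{\substack{n_0+\dots+n_{k-1}=nk\\ n_0,\dots,n_{k-1}\ge 0}}\left(\prod_{j=0}^{k-1}\frac{B_{2n_j}}{(2n_j)!}(2-4^{n_j})\right)\rho_k^{\sum_{j=0}^{k-1}2jn_j}$$ are rational, and in $L$ $$\zeta_R(\{2k\}^n)=c_{k,n}\frac{\lambda^{2nk}}{4^{nk}},\qquad \zeta_R^\star(\{2k\}^n)=c^\star_{k,n}\frac{\lambda^{2nk}}{4^{nk}}.$$ In particular, for every $n\ge 0$, $$\zeta_R(\{4\}^n)=\frac{2\lambda^{4n}}{4^n(4n+2)!}.$$ -/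

import Mathlib

namespace MZV

/-- The alphabet `A = {x, y}`. -/
inductive Letter where
  | x : Letter
  | y : Letter

section Algebra

variable (K : Type*) [Field K]

/-- The algebra `𝔥 = K⟨x, y⟩` of noncommutative polynomials. -/
abbrev H : Type _ := FreeAlgebra K Letter

/-- The letter `x` as an element of `𝔥`. -/
def X : H K := FreeAlgebra.ι K Letter.x

/-- The letter `y` as an element of `𝔥`. -/
def Y : H K := FreeAlgebra.ι K Letter.y

/-- The word `a₁ a₂ ⋯ aₙ` as an element of `𝔥`. -/
def word (w : List Letter) : H K := (w.map (FreeAlgebra.ι K)).prod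

/-- The words form a `K`-basis of `𝔥`. -/
noncomputable def wordBasis : Module.Basis (List Letter) K (H K) :=
  (FreeAlgebra.basisFreeMonoid K Letter).reindex FreeMonoid.toList

@[simp] theorem word_nil : word K [] = 1 := rfl

@[simp] theorem word_cons (a : Letter) (w : List Letter) :
    word K (a :: w) = FreeAlgebra.ι K a * word K w := by
  simp [word]

@[simp] theorem word_append (u v : List Letter) :
    word K (u ++ v) = word K u * word K v := by
  simp [word]

@[simp] theorem wordBasis_apply (w : List Letter) : wordBasis K w = word K w := by
  simp [wordBasis, FreeAlgebra.basisFreeMonoid, word, FreeAlgebra.equivMonoidAlgebraFreeMonoid,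
    FreeMonoid.lift_apply]

/-- The subspace `𝔥¹ = K + 𝔥 y`. -/
noncomputable def h1 : Submodule K (H K) :=
  Submodule.span K {1} ⊔ LinearMap.range (LinearMap.mulRight K (Y K))

/-- The subspace `𝔥⁰ = K + x 𝔥 y`. -/
noncomputable def h0 : Submodule K (H K) :=
  Submodule.span K {1} ⊔
    LinearMap.range (LinearMap.mulLeft K (X K) ∘ₗ LinearMap.mulRight K (Y K))

theorem one_mem_h0 : (1 : H K) ∈ h0 K :=
  Submodule.mem_sup_left (Submodule.mem_span_singleton_self _)

theorem one_mem_h1 : (1 : H K) ∈ h1 K :=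
  Submodule.mem_sup_left (Submodule.mem_span_singleton_self _)

theorem mul_Y_mem_h1 (w : H K) : w * Y K ∈ h1 K :=
  Submodule.mem_sup_right ⟨w, rfl⟩

theorem X_mul_mul_Y_mem_h0 (w : H K) : X K * (w * Y K) ∈ h0 K :=
  Submodule.mem_sup_right ⟨w, rfl⟩

/-! ### The shuffle product -/

/-- The shuffle product of two words:
`w ⧢ 1 = 1 ⧢ w = w` and `au ⧢ bv = a (u ⧢ bv) + b (au ⧢ v)`. -/
noncomputable def shuffleWord : List Letter → List Letter → H K
  | [], v => word K v
  | a :: u, [] => word K (a :: u)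
  | a :: u, b :: v =>
      FreeAlgebra.ι K a * shuffleWord u (b :: v) + FreeAlgebra.ι K b * shuffleWord (a :: u) v
  termination_by u v => u.length + v.length

/-- The shuffle product on `𝔥`, the bilinear extension of the product on words. -/
noncomputable def shuffle : H K →ₗ[K] H K →ₗ[K] H K :=
  (wordBasis K).constr K fun u => (wordBasis K).constr K fun v => shuffleWord K u v

@[simp] theorem shuffle_word (u v : List Letter) :
    shuffle K (word K u) (word K v) = shuffleWord K u v := by
  simp only [shuffle, ← wordBasis_apply, Module.Basis.constr_basis]

/-! ### The stuffle product -/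

/-- `z_k = x^{k-1} y`. -/
noncomputable def z (k : ℕ+) : H K := X K ^ ((k : ℕ) - 1) * Y K

/-- `z_{k₁} z_{k₂} ⋯ z_{kₙ}`. -/
noncomputable def zWord (ks : List ℕ+) : H K := (ks.map (z K)).prod

@[simp] theorem zWord_nil : zWord K [] = 1 := rfl

@[simp] theorem zWord_cons (k : ℕ+) (ks : List ℕ+) : zWord K (k :: ks) = z K k * zWord K ks := by
  simp [zWord]

/-- The stuffle product of `z_{k₁} ⋯ z_{kₘ}` and `z_{l₁} ⋯ z_{lₙ}`: `w * 1 = 1 * w = w` and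
`z_k u * z_l v = z_k (u * z_l v) + z_l (z_k u * v) + z_{k+l} (u * v)`. -/
noncomputable def stuffleIndex : List ℕ+ → List ℕ+ → H K
  | [], v => zWord K v
  | k :: u, [] => zWord K (k :: u)
  | k :: u, l :: v =>
      z K k * stuffleIndex u (l :: v) + z K l * stuffleIndex (k :: u) v
        + z K (k + l) * stuffleIndex u v
  termination_by u v => u.length + v.length

/-- Auxiliary function for `blocks`; `m` is the number of letters `x` read since the last `y`. -/
def blocksAux : ℕ → List Letter → List ℕ+
  | _, [] => []
  | m, Letter.x :: w => blocksAux (m + 1) w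
  | m, Letter.y :: w => m.succPNat :: blocksAux 0 w

/-- The index `(k₁, …, kₙ)` such that a word of `𝔥¹` is `z_{k₁} ⋯ z_{kₙ}`
(letters `x` at the end of a word that is not in `𝔥¹` are ignored). -/
def blocks (w : List Letter) : List ℕ+ := blocksAux 0 w

/-- The word of letters of `z_{k₁} ⋯ z_{kₙ}`. -/
def letters (ks : List ℕ+) : List Letter :=
  ks.flatMap fun k => List.replicate ((k : ℕ) - 1) Letter.x ++ [Letter.y]

theorem word_letters (ks : List ℕ+) : word K (letters ks) = zWord K ks := by
  induction ks with
  | nil => simp [letters]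
  | cons k ks ih =>
    have h : letters (k :: ks)
        = List.replicate ((k : ℕ) - 1) Letter.x ++ [Letter.y] ++ letters ks := by
      simp [letters]
    rw [h, word_append, ih]
    simp [z, X, Y, word]

theorem blocksAux_replicate (m j : ℕ) (w : List Letter) :
    blocksAux m (List.replicate j Letter.x ++ Letter.y :: w)
      = (m + j).succPNat :: blocksAux 0 w := by
  induction j generalizing m with
  | zero => simp [blocksAux]
  | succ j ih =>
    rw [List.replicate_succ, List.cons_append, blocksAux, ih]
    congr 2
    omega

theorem blocks_letters (ks : List ℕ+) : blocks (letters ks) = ks := by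
  induction ks with
  | nil => rfl
  | cons k ks ih =>
    have h : letters (k :: ks)
        = List.replicate ((k : ℕ) - 1) Letter.x ++ Letter.y :: letters ks := by
      simp [letters]
    rw [h, blocks, blocksAux_replicate, show blocksAux 0 (letters ks) = ks from ih]
    congr 1
    apply PNat.coe_injective
    have := k.pos
    simp only [Nat.succPNat_coe]
    omega

/-- The stuffle product on `𝔥¹`, extended bilinearly from the words `z_{k₁} ⋯ z_{kₙ}`. It is
declared on all of `𝔥` but only meaningful, and only used, on `𝔥¹`. -/
noncomputable def stuffle : H K →ₗ[K] H K →ₗ[K] H K :=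
  (wordBasis K).constr K fun u => (wordBasis K).constr K fun v =>
    stuffleIndex K (blocks u) (blocks v)

theorem stuffle_word (u v : List Letter) :
    stuffle K (word K u) (word K v) = stuffleIndex K (blocks u) (blocks v) := by
  simp only [stuffle, ← wordBasis_apply, Module.Basis.constr_basis]

theorem stuffle_zWord (ks ls : List ℕ+) :
    stuffle K (zWord K ks) (zWord K ls) = stuffleIndex K ks ls := by
  rw [← word_letters, ← word_letters, stuffle_word, blocks_letters, blocks_letters]

/-! ### `𝔥⁰` is closed under both products -/

theorem h0_eq_span : h0 K = Submodule.span K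
    ({1} ∪ Set.range fun w : List Letter => word K (Letter.x :: (w ++ [Letter.y]))) := by
  rw [Submodule.span_union, h0]
  congr 1
  rw [LinearMap.range_eq_map, ← (wordBasis K).span_eq, Submodule.map_span, ← Set.range_comp]
  congr 2
  ext w
  simp [X, Y]

theorem bilin_mem_h0 (B : H K →ₗ[K] H K →ₗ[K] H K)
    (h11 : B 1 1 ∈ h0 K)
    (h1w : ∀ w : List Letter, B 1 (word K (Letter.x :: (w ++ [Letter.y]))) ∈ h0 K)
    (hw1 : ∀ w : List Letter, B (word K (Letter.x :: (w ++ [Letter.y]))) 1 ∈ h0 K)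
    (hww : ∀ u v : List Letter, B (word K (Letter.x :: (u ++ [Letter.y])))
      (word K (Letter.x :: (v ++ [Letter.y]))) ∈ h0 K)
    {u v : H K} (hu : u ∈ h0 K) (hv : v ∈ h0 K) : B u v ∈ h0 K := by
  have key : Submodule.map₂ B (h0 K) (h0 K) ≤ h0 K := by
    conv_lhs => rw [h0_eq_span]
    rw [Submodule.map₂_span_span, Submodule.span_le]
    rintro _ ⟨a, ha, b, hb, rfl⟩
    rcases ha with rfl | ⟨a, rfl⟩ <;> rcases hb with rfl | ⟨b, rfl⟩
    · exact h11
    · exact h1w b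
    · exact hw1 a
    · exact hww a b
  exact key (Submodule.apply_mem_map₂ B hu hv)

theorem shuffleWord_nil_right (u : List Letter) : shuffleWord K u [] = word K u := by
  cases u <;> simp [shuffleWord]

theorem shuffleWord_append_y (u v : List Letter) :
    ∃ w, shuffleWord K (u ++ [Letter.y]) (v ++ [Letter.y]) = w * Y K := by
  induction u generalizing v with
  | nil =>
    induction v with
    | nil => exact ⟨Y K + Y K, by simp [shuffleWord, Y, add_mul]⟩
    | cons b v ih =>
      obtain ⟨w, hw⟩ := ih
      refine ⟨Y K * word K (b :: v) + FreeAlgebra.ι K b * w, ?_⟩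
      simp only [List.nil_append, List.cons_append] at hw ⊢
      rw [shuffleWord, hw, shuffleWord]
      simp [Y, add_mul, mul_assoc]
  | cons a u ih =>
    induction v with
    | nil =>
      obtain ⟨w, hw⟩ := ih []
      refine ⟨FreeAlgebra.ι K a * w + Y K * word K (a :: u), ?_⟩
      simp only [List.nil_append, List.cons_append] at hw ⊢
      rw [shuffleWord, hw, shuffleWord]
      simp [Y, add_mul, mul_assoc]
    | cons b v ih2 =>
      obtain ⟨w, hw⟩ := ih (b :: v)
      obtain ⟨w', hw'⟩ := ih2
      refine ⟨FreeAlgebra.ι K a * w + FreeAlgebra.ι K b * w', ?_⟩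
      simp only [List.cons_append] at hw hw' ⊢
      rw [shuffleWord, hw, hw']
      simp [add_mul, mul_assoc]

theorem shuffle_mem_h0 {u v : H K} (hu : u ∈ h0 K) (hv : v ∈ h0 K) :
    shuffle K u v ∈ h0 K := by
  have hx : ∀ w : List Letter, word K (Letter.x :: (w ++ [Letter.y])) ∈ h0 K := fun w => by
    have := X_mul_mul_Y_mem_h0 K (word K w)
    simpa [X, Y] using this
  refine bilin_mem_h0 K _ ?_ ?_ ?_ ?_ hu hv
  · rw [← word_nil, shuffle_word, shuffleWord]
    exact one_mem_h0 K
  · intro w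
    rw [← word_nil, shuffle_word, shuffleWord]
    exact hx w
  · intro w
    rw [← word_nil, shuffle_word, shuffleWord_nil_right]
    exact hx w
  · intro u v
    rw [shuffle_word, shuffleWord]
    refine Submodule.add_mem _ ?_ ?_
    · obtain ⟨w, hw⟩ := shuffleWord_append_y K u (Letter.x :: v)
      rw [List.cons_append] at hw
      rw [hw]
      exact X_mul_mul_Y_mem_h0 K w
    · obtain ⟨w, hw⟩ := shuffleWord_append_y K (Letter.x :: u) v
      rw [List.cons_append] at hw
      rw [hw]
      exact X_mul_mul_Y_mem_h0 K w

theorem z_mul_mem_h1 (k : ℕ+) {w : H K} (hw : w ∈ h1 K) : z K k * w ∈ h1 K := by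
  obtain ⟨a, ha, b, ⟨c, rfl⟩, rfl⟩ := Submodule.mem_sup.1 hw
  obtain ⟨r, rfl⟩ := Submodule.mem_span_singleton.1 ha
  have : z K k * (r • 1 + LinearMap.mulRight K (Y K) c)
      = (r • X K ^ ((k : ℕ) - 1) + z K k * c) * Y K := by
    simp [z, mul_add, add_mul, mul_assoc]
  rw [this]
  exact mul_Y_mem_h1 K _

theorem z_mul_mem_h0 (k : ℕ+) (hk : 2 ≤ k) {w : H K} (hw : w ∈ h1 K) : z K k * w ∈ h0 K := by
  obtain ⟨a, ha, b, ⟨c, rfl⟩, rfl⟩ := Submodule.mem_sup.1 hw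
  obtain ⟨r, rfl⟩ := Submodule.mem_span_singleton.1 ha
  have hk' : 2 ≤ (k : ℕ) := hk
  obtain ⟨m, hm⟩ : ∃ m, (k : ℕ) - 1 = m + 1 := ⟨(k : ℕ) - 2, by omega⟩
  have : z K k * (r • 1 + LinearMap.mulRight K (Y K) c)
      = X K * ((r • X K ^ m + X K ^ m * Y K * c) * Y K) := by
    simp [z, hm, pow_succ', mul_add, add_mul, mul_assoc]
  rw [this]
  exact X_mul_mul_Y_mem_h0 K _

theorem zWord_mem_h1 (ks : List ℕ+) : zWord K ks ∈ h1 K := by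
  induction ks with
  | nil => exact one_mem_h1 K
  | cons k ks ih => rw [zWord_cons]; exact z_mul_mem_h1 K k ih

theorem stuffleIndex_nil_right (u : List ℕ+) : stuffleIndex K u [] = zWord K u := by
  cases u <;> simp [stuffleIndex]

theorem stuffleIndex_mem_h1 (ks ls : List ℕ+) : stuffleIndex K ks ls ∈ h1 K := by
  induction ks generalizing ls with
  | nil => rw [stuffleIndex]; exact zWord_mem_h1 K ls
  | cons k ks ih =>
    induction ls with
    | nil => rw [stuffleIndex]; exact zWord_mem_h1 K _
    | cons l ls ih2 =>
      rw [stuffleIndex]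
      exact Submodule.add_mem _ (Submodule.add_mem _ (z_mul_mem_h1 K k (ih _))
        (z_mul_mem_h1 K l ih2)) (z_mul_mem_h1 K _ (ih _))

theorem blocks_x_y (w : List Letter) :
    ∃ k ks, (2 : ℕ+) ≤ k ∧ blocks (Letter.x :: (w ++ [Letter.y])) = k :: ks := by
  have aux : ∀ (w : List Letter) (m : ℕ), ∃ k ks, (m + 1).succPNat ≤ k ∧
      blocksAux (m + 1) (w ++ [Letter.y]) = k :: ks := by
    intro w
    induction w with
    | nil => intro m; exact ⟨_, _, le_refl _, rfl⟩
    | cons a w ih =>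
      intro m
      cases a with
      | x =>
        obtain ⟨k, ks, hk, h⟩ := ih (m + 1)
        exact ⟨k, ks, le_trans (by simp [Nat.succPNat_le_succPNat]) hk, h⟩
      | y => exact ⟨_, _, le_refl _, rfl⟩
  obtain ⟨k, ks, hk, h⟩ := aux w 0
  exact ⟨k, ks, hk, h⟩

theorem stuffle_mem_h0 {u v : H K} (hu : u ∈ h0 K) (hv : v ∈ h0 K) :
    stuffle K u v ∈ h0 K := by
  have h1 : ∀ (k : ℕ+) (ks : List ℕ+), 2 ≤ k → zWord K (k :: ks) ∈ h0 K := fun k ks hk => by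
    rw [zWord_cons]; exact z_mul_mem_h0 K k hk (zWord_mem_h1 K ks)
  refine bilin_mem_h0 K _ ?_ ?_ ?_ ?_ hu hv
  · rw [← word_nil, stuffle_word]
    simpa [blocks, blocksAux, stuffleIndex] using one_mem_h0 K
  · intro w
    obtain ⟨k, ks, hk, h⟩ := blocks_x_y w
    rw [← word_nil, stuffle_word, h]
    simpa [blocks, blocksAux, stuffleIndex] using h1 k ks hk
  · intro w
    obtain ⟨k, ks, hk, h⟩ := blocks_x_y w
    rw [← word_nil, stuffle_word, h]
    simpa [blocks, blocksAux, stuffleIndex] using h1 k ks hk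
  · intro u v
    obtain ⟨k, ks, hk, h⟩ := blocks_x_y u
    obtain ⟨l, ls, hl, h'⟩ := blocks_x_y v
    rw [stuffle_word, h, h', stuffleIndex]
    refine Submodule.add_mem _ (Submodule.add_mem _ ?_ ?_) ?_
    · exact z_mul_mem_h0 K k hk (stuffleIndex_mem_h1 K _ _)
    · exact z_mul_mem_h0 K l hl (stuffleIndex_mem_h1 K _ _)
    · exact z_mul_mem_h0 K _ (hk.trans (PNat.lt_add_right k l).le) (stuffleIndex_mem_h1 K _ _)

/-- The shuffle product restricted to `𝔥⁰`. -/
noncomputable def shuffle0 (u v : h0 K) : h0 K :=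
  ⟨shuffle K u v, shuffle_mem_h0 K u.2 v.2⟩

/-- The stuffle product restricted to `𝔥⁰`. -/
noncomputable def stuffle0 (u v : h0 K) : h0 K :=
  ⟨stuffle K u v, stuffle_mem_h0 K u.2 v.2⟩

/-! ### The map `S` -/

/-- The algebra endomorphism `σ` of `𝔥` with `σ(x) = x` and `σ(y) = x + y`. -/
noncomputable def sigma : H K →ₐ[K] H K :=
  FreeAlgebra.lift K fun a => match a with
    | Letter.x => X K
    | Letter.y => X K + Y K

/-- The value of `S` on the reversal of a word. -/
noncomputable def SRev : List Letter → H K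
  | [] => 1
  | a :: w => sigma K (word K w.reverse) * FreeAlgebra.ι K a

/-- The linear map `S` on `𝔥` with `S(1) = 1` and `S(w a) = σ(w) a` for a letter `a`. -/
noncomputable def S : H K →ₗ[K] H K :=
  (wordBasis K).constr K fun w => SRev K w.reverse

theorem S_one : S K 1 = 1 := by
  have h : (1 : H K) = wordBasis K [] := by simp
  conv_lhs => rw [h]
  rw [S, Module.Basis.constr_basis]
  rfl

theorem S_mul_letter (w : H K) (a : Letter) :
    S K (w * FreeAlgebra.ι K a) = sigma K w * FreeAlgebra.ι K a := by
  have : S K ∘ₗ LinearMap.mulRight K (FreeAlgebra.ι K a)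
      = LinearMap.mulRight K (FreeAlgebra.ι K a) ∘ₗ (sigma K).toLinearMap := by
    refine (wordBasis K).ext fun w => ?_
    have h : word K w * FreeAlgebra.ι K a = wordBasis K (w ++ [a]) := by simp
    simp only [LinearMap.comp_apply, LinearMap.mulRight_apply, wordBasis_apply,
      AlgHom.toLinearMap_apply]
    rw [h, S, Module.Basis.constr_basis]
    simp [SRev]
  exact LinearMap.congr_fun this w

theorem S_mem_h0 {w : H K} (hw : w ∈ h0 K) : S K w ∈ h0 K := by
  obtain ⟨a, ha, b, ⟨c, rfl⟩, rfl⟩ := Submodule.mem_sup.1 hw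
  obtain ⟨r, rfl⟩ := Submodule.mem_span_singleton.1 ha
  rw [map_add, map_smul, S_one]
  refine Submodule.add_mem _ (Submodule.smul_mem _ _ (one_mem_h0 K)) ?_
  have h : S K (X K * c * Y K) = X K * (sigma K c * Y K) := by
    rw [Y, S_mul_letter, map_mul, ← mul_assoc]
    simp [sigma, X]
  simp only [LinearMap.comp_apply, LinearMap.mulRight_apply, LinearMap.mulLeft_apply]
  rw [← mul_assoc, h]
  exact X_mul_mul_Y_mem_h0 K _

/-- The restriction of `S` to `𝔥⁰`. -/
noncomputable def S0 : h0 K →ₗ[K] h0 K :=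
  (S K).restrict fun _ hw => S_mem_h0 K hw

/-! ### Shuffle regularization -/

/-- The shuffle powers `y^{⧢ i}` of `y`. -/
noncomputable def shufflePowY : ℕ → H K
  | 0 => 1
  | i + 1 => shuffle K (Y K) (shufflePowY i)

/-- `IsShuffleReg K w v` says that `reg_⧢(w) = v`: the element `w` can be written as
`∑ i, wᵢ ⧢ y^{⧢ i}` with `wᵢ ∈ 𝔥⁰` and `w₀ = v`. -/
def IsShuffleReg (w : H K) (v : h0 K) : Prop :=
  ∃ f : ℕ →₀ h0 K, w = (f.sum fun i wi => shuffle K (wi : H K) (shufflePowY K i)) ∧ f 0 = v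

end Algebra

section Zeta

variable {K : Type*} [Field K] {R : Type*} [CommRing R] [Algebra K R]

/-- `Z` satisfies the (finite) double shuffle relations (normalized by `Z(1) = 1`). -/
structure DoubleShuffle (Z : h0 K →ₗ[K] R) : Prop where
  map_one : Z ⟨1, one_mem_h0 K⟩ = 1
  map_shuffle : ∀ u v : h0 K, Z (shuffle0 K u v) = Z u * Z v
  map_stuffle : ∀ u v : h0 K, Z (stuffle0 K u v) = Z u * Z v

/-- `Z` satisfies the regularized double shuffle relations: the double shuffle relations, and
`Z(reg_⧢(w₁ ⧢ w₀ - w₁ * w₀)) = 0` for all `w₁ ∈ 𝔥¹` and `w₀ ∈ 𝔥⁰`. -/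
structure RegularizedDoubleShuffle (Z : h0 K →ₗ[K] R) : Prop extends DoubleShuffle Z where
  map_reg : ∀ w₁ ∈ h1 K, ∀ w₀ ∈ h0 K, ∀ v : h0 K,
    IsShuffleReg K (shuffle K w₁ w₀ - stuffle K w₁ w₀) v → Z v = 0

/-- An index `(k₁, …, kₙ)` is admissible if it is empty or `k₁ ≥ 2`. -/
def Admissible (ks : List ℕ+) : Prop := ∀ k ∈ ks.head?, 2 ≤ k

theorem zWord_mem_h0 {ks : List ℕ+} (h : Admissible ks) : zWord K ks ∈ h0 K := by
  cases ks with
  | nil => exact one_mem_h0 K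
  | cons k ks =>
    rw [zWord_cons]
    exact z_mul_mem_h0 K k (h k (by simp)) (zWord_mem_h1 K ks)

theorem admissible_replicate (n : ℕ) {k : ℕ+} (hk : 2 ≤ k) :
    Admissible (List.replicate n k) := by
  intro m hm
  cases n with
  | zero => simp at hm
  | succ n => simp [List.replicate_succ] at hm; exact hm ▸ hk

/-- The multiple zeta value `ζ_R(k₁, …, kₙ) = Z(z_{k₁} ⋯ z_{kₙ})`. -/
noncomputable def zeta (Z : h0 K →ₗ[K] R) (ks : List ℕ+) (h : Admissible ks) : R :=
  Z ⟨zWord K ks, zWord_mem_h0 h⟩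

/-- The multiple zeta-star value `ζ_R^⋆(k₁, …, kₙ) = (Z ∘ S)(z_{k₁} ⋯ z_{kₙ})`. -/
noncomputable def zetaStar (Z : h0 K →ₗ[K] R) (ks : List ℕ+) (h : Admissible ks) : R :=
  (Z ∘ₗ S0 K) ⟨zWord K ks, zWord_mem_h0 h⟩

/-- `ζ_R({m}^n)`, with `m ≥ 2` repeated `n` times. -/
noncomputable def zetaRep (Z : h0 K →ₗ[K] R) (m : ℕ+) (hm : 2 ≤ m) (n : ℕ) : R :=
  zeta Z (List.replicate n m) (admissible_replicate n hm)

/-- `ζ_R^⋆({m}^n)`, with `m ≥ 2` repeated `n` times. -/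
noncomputable def zetaStarRep (Z : h0 K →ₗ[K] R) (m : ℕ+) (hm : 2 ≤ m) (n : ℕ) : R :=
  zetaStar Z (List.replicate n m) (admissible_replicate n hm)

theorem two_le_two_mul (k : ℕ+) : 2 ≤ 2 * k := le_mul_of_one_le_right' one_le

end Zeta

/-- `ρ_k = e^{πi/k}`. -/
noncomputable def rho (k : ℕ+) : ℂ := Complex.exp (Real.pi * Complex.I / (k : ℕ))

/-- `(-1)^n ∑ ρ_k^{∑ 2 j n_j} / ((2n_0+1)! ⋯ (2n_{k-1}+1)!)`, the sum over all
`n_0 + ⋯ + n_{k-1} = nk`. -/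
noncomputable def coeff (k : ℕ+) (n : ℕ) : ℂ :=
  (-1) ^ n * ∑ ν ∈ Finset.Nat.antidiagonalTuple (k : ℕ) (n * k),
    rho k ^ (∑ j : Fin (k : ℕ), 2 * (j : ℕ) * ν j) / ∏ j, ((2 * ν j + 1).factorial : ℂ)

/-- `∑ (∏ B_{2n_j} (2 - 4^{n_j}) / (2n_j)!) ρ_k^{∑ 2 j n_j}`, the sum over all
`n_0 + ⋯ + n_{k-1} = nk`. -/
noncomputable def coeffStar (k : ℕ+) (n : ℕ) : ℂ :=
  ∑ ν ∈ Finset.Nat.antidiagonalTuple (k : ℕ) (n * k),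
    (∏ j, ((bernoulli (2 * ν j) : ℚ) : ℂ) / ((2 * ν j).factorial : ℂ) * (2 - 4 ^ ν j))
      * rho k ^ (∑ j : Fin (k : ℕ), 2 * (j : ℕ) * ν j)

end MZV

/-! Put τ = -6 ζ_R(2), so that λ² = 4τ; formally τ plays the role of -π². The claim becomes
ζ_R({2k}^n) = c_{k,n} τ^{nk}, and likewise for ζ^⋆. Both sides satisfy one Newton recursion, whose
solution is unique because n + 1 is invertible in characteristic zero.

Algebraic side. In weight 2n + 4, comparing shuffle and stuffle products of two letters z_a, z_b
gives the sum formula and an alternating sum formula for double zeta values. Together they yield the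
quadratic recursion `IsExtension.sum_even_mul_even` for even zeta values. The regularized relation
is needed only for y against a single z_b, where it is Hoffman's relation. Stuffling z_{im} with
z_m^n, or with S(z_m^n), then gives the Newton identities relating power sums ζ_R(im) to elementary
symmetric functions ζ_R({m}^n) (`IsExtension.zeta_newton`) and to complete ones ζ_R^⋆({m}^n)
(`IsExtension.zetaStar_newton`).

Numerical side. Let F(T) = sinh(√T)/√T. The differential equation of F makes G = -T F'/F satisfy a
Riccati equation, whose coefficients obey the same quadratic recursion. Hence ζ_R(2n) = [T^n]G · τ^n
(`IsExtension.map_z_even`). Up to sign, c_{k,n} is the coefficient of T^{nk} in ∏_j F(ρ_k^{2j} T),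
and c^⋆_{k,n} is that coefficient for 1/F. The logarithmic derivative of such a product sums G over
the k-th roots of unity, keeping only exponents divisible by k. This is the Newton recursion
(`rootSum_newton`), and its rational coefficients also force c_{k,n} and c^⋆_{k,n} to be rational.
-/

open PowerSeries Finset in
/-- A logarithmic derivative: the derivative of a product of power series. -/
theorem PowerSeries.X_mul_derivative_prod {A ι : Type*} [CommRing A] (s : Finset ι)
    (f g : ι → A⟦X⟧) (h : ∀ i ∈ s, X * d⁄dX A (f i) = g i * f i) :
    X * d⁄dX A (∏ i ∈ s, f i) = (∑ i ∈ s, g i) * ∏ i ∈ s, f i := by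
  classical
  induction s using Finset.induction_on with
  | empty => simp
  | insert a s ha ih =>
    rw [Finset.prod_insert ha, Finset.sum_insert ha, Derivation.leibniz, smul_eq_mul, smul_eq_mul]
    have h1 := h a (by simp)
    have h2 := ih fun i hi => h i (by simp [hi])
    linear_combination (f a) * h2 + (∏ i ∈ s, f i) * h1

namespace MZVSeries

/-! ### The series sinh(√T)/√T, its logarithmic derivative, and Newton recursions -/

section Series

open PowerSeries Finset

/-- The power series `∑ Tⁿ / (2n+1)! = sinh(√T) / √T`. -/
noncomputable def sinhSeries : ℚ⟦X⟧ := PowerSeries.mk fun n => ((2 * n + 1).factorial : ℚ)⁻¹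

theorem constantCoeff_sinhSeries : constantCoeff sinhSeries = 1 := by
  simp [sinhSeries, ← coeff_zero_eq_constantCoeff_apply]

/-- Minus the logarithmic derivative of `sinhSeries` with respect to `T d/dT`. Its `n`-th
coefficient is the rational number `ζ(2n) / (-π²)ⁿ`. -/
noncomputable def evenZetaSeries : ℚ⟦X⟧ := -(X * d⁄dX ℚ sinhSeries) * sinhSeries⁻¹

theorem sinhSeries_mul_inv : sinhSeries * sinhSeries⁻¹ = 1 :=
  PowerSeries.mul_inv_cancel _ (by simp [constantCoeff_sinhSeries])

theorem X_mul_derivative_sinhSeries :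
    X * d⁄dX ℚ sinhSeries = -evenZetaSeries * sinhSeries := by
  rw [evenZetaSeries]
  linear_combination -(X * d⁄dX ℚ sinhSeries) * sinhSeries_mul_inv

/-- Coefficientwise this is 4n² + 2n = 2n(2n + 1), the ratio of consecutive factorials (2n + 1)! and
(2n - 1)!. -/
theorem sinhSeries_ode :
    4 * (X * d⁄dX ℚ (X * d⁄dX ℚ sinhSeries)) + 2 * (X * d⁄dX ℚ sinhSeries) = X * sinhSeries := by
  ext n
  have h4 : (4 : ℚ⟦X⟧) = C 4 := rfl
  have h2 : (2 : ℚ⟦X⟧) = C 2 := rfl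
  rw [h4, h2]
  cases n with
  | zero => simp
  | succ n =>
    have h : ∀ f : ℚ⟦X⟧, coeff (n + 1) (X * d⁄dX ℚ f) = (n + 1) * coeff (n + 1) f := by
      intro f
      rw [coeff_succ_X_mul, coeff_derivative, mul_comm]
    rw [map_add, coeff_C_mul, coeff_C_mul, h, h, coeff_succ_X_mul]
    simp only [sinhSeries, coeff_mk]
    have e : 2 * (n + 1) + 1 = (2 * n + 1) + 1 + 1 := by ring
    rw [e, Nat.factorial_succ, Nat.factorial_succ]
    have := Nat.factorial_ne_zero (2 * n + 1)
    push_cast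
    field_simp
    ring

/-- The Riccati equation: substitute D F = -G F and D²F = (G² - D G) F, where D = T d/dT, into the
linear equation for F and cancel F. Its quadratic term becomes the convolution in the recursion for
even zeta values. -/
theorem X_mul_derivative_evenZetaSeries :
    2 * (X * d⁄dX ℚ evenZetaSeries) + evenZetaSeries = 2 * evenZetaSeries ^ 2 - C (1 / 2) * X := by
  have hne : sinhSeries ≠ 0 := fun h => by
    have := constantCoeff_sinhSeries
    simp [h] at this
  have h := sinhSeries_ode
  have h1 := X_mul_derivative_sinhSeries
  rw [h1, Derivation.leibniz, smul_eq_mul, smul_eq_mul, map_neg] at h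
  have hC : C (1 / 2 : ℚ) * 2 = (1 : ℚ⟦X⟧) := by
    have h2 : (2 : ℚ⟦X⟧) = C 2 := rfl
    rw [h2, ← map_mul]
    norm_num
  apply mul_right_cancel₀ hne
  linear_combination (-C (1 / 2 : ℚ)) * h - C (1 / 2 : ℚ) * 4 * evenZetaSeries * h1 + (-2 * X * d⁄dX ℚ evenZetaSeries * sinhSeries
    + 2 * evenZetaSeries ^ 2 * sinhSeries - evenZetaSeries * sinhSeries) * hC

/-- The rational numbers `ζ(2n) / (-π²)ⁿ`. -/
noncomputable def evenZetaCoeff (n : ℕ) : ℚ := coeff n evenZetaSeries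

theorem evenZetaCoeff_zero : evenZetaCoeff 0 = 0 := by
  simp [evenZetaCoeff, evenZetaSeries]

theorem evenZetaCoeff_succ (n : ℕ) :
    (2 * n + 3) * evenZetaCoeff (n + 1)
      = 2 * (∑ p ∈ antidiagonal (n + 1), evenZetaCoeff p.1 * evenZetaCoeff p.2)
        - if n = 0 then 1 / 2 else 0 := by
  have h := congrArg (coeff (n + 1)) X_mul_derivative_evenZetaSeries
  have h2 : (2 : ℚ⟦X⟧) = C 2 := rfl
  rw [h2, map_add, map_sub, coeff_C_mul, coeff_C_mul, coeff_C_mul, coeff_succ_X_mul,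
    coeff_derivative, pow_two, coeff_mul, coeff_X] at h
  simp only [evenZetaCoeff]
  simp only [Nat.add_eq_right] at h
  split_ifs at h ⊢ <;> linear_combination h

theorem evenZetaCoeff_one : evenZetaCoeff 1 = -1 / 6 := by
  have h := evenZetaCoeff_succ 0
  rw [Finset.Nat.sum_antidiagonal_eq_sum_range_succ fun i j => evenZetaCoeff i * evenZetaCoeff j]
    at h
  simp [evenZetaCoeff_zero, Finset.sum_range_succ] at h
  linarith

/-- The recursion `∑_{i=1}^{n-1} ζ(2i) ζ(2n-2i) = (n + 1/2) ζ(2n)`. -/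
theorem evenZetaCoeff_add_two (n : ℕ) :
    (2 * n + 5) * evenZetaCoeff (n + 2)
      = 2 * ∑ i ∈ range (n + 1), evenZetaCoeff (i + 1) * evenZetaCoeff (n + 1 - i) := by
  have h := evenZetaCoeff_succ (n + 1)
  rw [Finset.Nat.sum_antidiagonal_eq_sum_range_succ fun i j => evenZetaCoeff i * evenZetaCoeff j,
    Finset.sum_range_succ, Finset.sum_range_succ'] at h
  simp only [Nat.sub_self, evenZetaCoeff_zero, Nat.add_eq_zero_iff, one_ne_zero, and_false,
    if_false, mul_zero, zero_mul, add_zero, sub_zero] at h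
  push_cast at h
  rw [show (2 * n + 5 : ℚ) = 2 * (n + 1) + 3 by ring]
  rw [h]

/-- A complex sequence satisfying a Newton recursion with rational coefficients is rational. -/
theorem exists_rat_of_newton (p : ℕ → ℚ) (f : ℕ → ℂ) (h0 : f 0 = 1)
    (hf : ∀ n : ℕ, ((n + 1 : ℕ) : ℂ) * f (n + 1) = ∑ i ∈ range (n + 1), (p (i + 1) : ℂ) * f (n - i)) :
    ∃ c : ℕ → ℚ, (∀ n, (c n : ℂ) = f n) ∧ c 0 = 1 ∧
      ∀ n : ℕ, ((n + 1 : ℕ) : ℚ) * c (n + 1) = ∑ i ∈ range (n + 1), p (i + 1) * c (n - i) := by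
  have key : ∀ n, ∃ c : ℚ, (c : ℂ) = f n := by
    intro n
    induction n using Nat.strong_induction_on with
    | _ n ih =>
      cases n with
      | zero => exact ⟨1, by simp [h0]⟩
      | succ n =>
        choose! c hc using ih
        refine ⟨(∑ i ∈ range (n + 1), p (i + 1) * c (n - i)) / (n + 1 : ℕ), ?_⟩
        have hn : ((n + 1 : ℕ) : ℂ) ≠ 0 := Nat.cast_ne_zero.2 n.succ_ne_zero
        push_cast at hn hf ⊢
        rw [div_eq_iff hn, mul_comm, hf]
        refine Finset.sum_congr rfl fun i hi => ?_
        rw [hc (n - i) (by omega)]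
  choose c hc using key
  refine ⟨c, hc, ?_, fun n => ?_⟩
  · have := hc 0
    rw [h0] at this
    exact_mod_cast this
  · have := hf n
    simp only [← hc] at this
    exact_mod_cast this

/-- A Newton recursion in a `K`-algebra whose coefficients are rational multiples of powers of `τ`
is solved by the same rational multiples of powers of `τ`. -/
theorem eq_smul_pow_of_newton {K R : Type*} [Field K] [CharZero K] [CommRing R] [Algebra K R]
    {p c : ℕ → ℚ} {P e : ℕ → R} {τ : R} (hc0 : c 0 = 1)
    (hc : ∀ n : ℕ, ((n + 1 : ℕ) : ℚ) * c (n + 1) = ∑ i ∈ range (n + 1), p (i + 1) * c (n - i))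
    (he0 : e 0 = 1)
    (he : ∀ n : ℕ, ((n + 1 : ℕ) : R) * e (n + 1) = ∑ i ∈ range (n + 1), P (i + 1) * e (n - i))
    (hP : ∀ i : ℕ, P (i + 1) = (p (i + 1) : K) • τ ^ (i + 1)) (n : ℕ) :
    e n = (c n : K) • τ ^ n := by
  induction n using Nat.strong_induction_on with
  | _ n ih =>
    cases n with
    | zero => simp [he0, hc0]
    | succ n =>
      have hn : ((n + 1 : ℕ) : K) ≠ 0 := Nat.cast_ne_zero.2 n.succ_ne_zero
      have h1 : ((n + 1 : ℕ) : K) • e (n + 1) = ((n + 1 : ℕ) : K) • ((c (n + 1) : K) • τ ^ (n + 1)) := by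
        rw [smul_smul]
        have h2 : ((n + 1 : ℕ) : K) * (c (n + 1) : K)
            = ∑ i ∈ range (n + 1), (p (i + 1) : K) * (c (n - i) : K) := by
          exact_mod_cast congrArg (Rat.cast : ℚ → K) (hc n)
        rw [h2, Algebra.smul_def, map_natCast, he, Finset.sum_smul]
        refine Finset.sum_congr rfl fun i hi => ?_
        have hi' : i ≤ n := by simpa [Nat.lt_succ_iff] using hi
        rw [hP, ih (n - i) (by omega), smul_mul_smul_comm, ← pow_add]
        congr 2
        omega
      exact smul_right_injective _ hn h1

end Series

end MZVSeries

namespace MZVSeries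

/-! ### The reciprocal series t / sinh t and Bernoulli numbers -/

section Bernoulli

open PowerSeries Finset

theorem two_mul_X_mul_expand_sinhSeries :
    2 * (X * expand 2 two_ne_zero sinhSeries) = exp ℚ - evalNegHom (exp ℚ) := by
  have h2 : (2 : ℚ⟦X⟧) = C 2 := rfl
  ext n
  rw [h2, coeff_C_mul, map_sub, evalNegHom, coeff_rescale, coeff_exp]
  cases n with
  | zero => simp
  | succ n =>
    rw [coeff_succ_X_mul, coeff_expand]
    split_ifs with h
    · obtain ⟨m, rfl⟩ := h
      simp [sinhSeries, pow_succ, pow_mul]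
      ring
    · have h' : Even (n + 1) := by
        rw [← even_iff_two_dvd] at h
        simpa [Nat.even_add_one] using h
      simp [h'.neg_one_pow]

/-- The power series `t / sinh t` in terms of Bernoulli numbers. -/
theorem expand_bernoulli_mul_sinhSeries :
    expand 2 two_ne_zero (PowerSeries.mk fun n =>
      bernoulli (2 * n) / ((2 * n).factorial : ℚ) * (2 - 4 ^ n))
      = 2 * bernoulliPowerSeries ℚ - rescale 2 (bernoulliPowerSeries ℚ) := by
  have h2 : (2 : ℚ⟦X⟧) = C 2 := rfl
  ext n
  rw [h2, map_sub, coeff_C_mul, coeff_rescale, coeff_expand, bernoulliPowerSeries, coeff_mk]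
  split_ifs with h
  · obtain ⟨m, rfl⟩ := h
    simp [pow_mul]
    norm_num
    ring
  · have h' : Odd n := by
      rw [← even_iff_two_dvd] at h
      simpa using h
    -- Odd Bernoulli numbers vanish except B_1, and there the factor 2 - 2^1 vanishes.
    rcases Nat.lt_or_ge 1 n with h1 | h1
    · simp [bernoulli_eq_zero_of_odd h' h1]
    · obtain rfl : n = 1 := by
        obtain ⟨m, rfl⟩ := h'
        omega
      simp

/-- With T = t² (the role of `expand 2`), t / sinh t = 2t e^t/(e^{2t} - 1) = 2t/(e^t - 1) -
2t/(e^{2t} - 1), which is 2b(t) - b(2t) for the Bernoulli series b. The identity is checked after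
multiplying by the nonzero series 2t e^t. -/
theorem sinhSeries_inv : sinhSeries⁻¹ = PowerSeries.mk fun n =>
    bernoulli (2 * n) / ((2 * n).factorial : ℚ) * (2 - 4 ^ n) := by
  set V : ℚ⟦X⟧ := PowerSeries.mk fun n =>
    bernoulli (2 * n) / ((2 * n).factorial : ℚ) * (2 - 4 ^ n) with hV
  have hW := expand_bernoulli_mul_sinhSeries
  rw [← hV] at hW
  set W := expand 2 two_ne_zero V
  have hS := two_mul_X_mul_expand_sinhSeries
  have hb := bernoulliPowerSeries_mul_exp_sub_one ℚ
  have hb2 := congrArg (rescale (2 : ℚ)) hb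
  have he : rescale (2 : ℚ) (exp ℚ) = exp ℚ ^ 2 := by
    have := exp_pow_eq_rescale_exp (A := ℚ) 2
    exact_mod_cast this.symm
  have hX : rescale (2 : ℚ) X = (2 : ℚ⟦X⟧) * X := by
    have h2 : (2 : ℚ⟦X⟧) = C 2 := rfl
    rw [h2, rescale_X]
  rw [map_mul, map_sub, map_one, he, hX] at hb2
  have hneg := exp_mul_exp_neg_eq_one (A := ℚ)
  have key : W * expand 2 two_ne_zero sinhSeries = 1 := by
    have hx : (2 * X * exp ℚ : ℚ⟦X⟧) ≠ 0 := by
      refine mul_ne_zero (mul_ne_zero (fun h => by simpa using congrArg (coeff 0) ((rfl : C (2 : ℚ) = 2).trans h)) X_ne_zero) fun h => ?_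
      rw [h, zero_mul] at hneg
      exact zero_ne_one hneg
    apply mul_left_cancel₀ hx
    rw [hW]
    linear_combination
      (2 * bernoulliPowerSeries ℚ - rescale 2 (bernoulliPowerSeries ℚ)) * (exp ℚ * hS - hneg)
      + 2 * (exp ℚ + 1) * hb - hb2
  rw [← map_mul, ← map_one (expand 2 two_ne_zero)] at key
  have hVF : V * sinhSeries = 1 := by
    ext n
    have := congrArg (coeff (2 * n)) key
    rwa [coeff_expand_mul, coeff_expand_mul] at this
  calc sinhSeries⁻¹ = V * sinhSeries * sinhSeries⁻¹ := by rw [hVF, one_mul]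
    _ = V := by rw [mul_assoc, sinhSeries_mul_inv, mul_one]

theorem X_mul_derivative_sinhSeries_inv :
    X * d⁄dX ℚ sinhSeries⁻¹ = evenZetaSeries * sinhSeries⁻¹ := by
  rw [derivative_inv', evenZetaSeries]
  ring

end Bernoulli

/-! ### Products over roots of unity and the Newton recursion for the constants -/

section Roots

open PowerSeries Finset

/-- The sum over `antidiagonalTuple k N` that is the `N`-th coefficient of
`∏ j, f (ρ_k^{2j} T)`. -/
noncomputable def rootSum (f : ℚ⟦X⟧) (k : ℕ+) (N : ℕ) : ℂ :=
  ∑ ν ∈ Finset.Nat.antidiagonalTuple (k : ℕ) N,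
    (∏ j, ((PowerSeries.coeff (ν j) f : ℚ) : ℂ))
      * MZV.rho k ^ (∑ j : Fin (k : ℕ), 2 * (j : ℕ) * ν j)

theorem coeff_prod_rescale (f : ℚ⟦X⟧) (k : ℕ+) (N : ℕ) :
    coeff N (∏ j : Fin (k : ℕ), rescale ((MZV.rho k ^ 2) ^ (j : ℕ)) (PowerSeries.map (algebraMap ℚ ℂ) f))
      = rootSum f k N := by
  classical
  rw [coeff_prod, rootSum]
  refine Finset.sum_bij' (fun l _ => (l : Fin (k : ℕ) → ℕ))
    (fun ν _ => Finsupp.equivFunOnFinite.symm ν) ?_ ?_ ?_ ?_ ?_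
  · intro l hl
    rw [mem_finsuppAntidiag'] at hl
    rw [Finset.Nat.mem_antidiagonalTuple, ← hl.1, Finsupp.sum_fintype _ _ (fun _ => rfl)]
  · intro ν hν
    rw [Finset.Nat.mem_antidiagonalTuple] at hν
    rw [mem_finsuppAntidiag]
    exact ⟨by simpa using hν, by simp⟩
  · intro l _
    simp
  · intro ν _
    simp
  · intro l _
    rw [← Finset.prod_pow_eq_pow_sum, ← Finset.prod_mul_distrib]
    refine Finset.prod_congr rfl fun j _ => ?_
    rw [coeff_rescale, coeff_map, mul_comm, ← pow_mul, ← pow_mul, ← mul_assoc]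
    rfl

theorem rootSum_zero (f : ℚ⟦X⟧) (hf : constantCoeff f = 1) (k : ℕ+) : rootSum f k 0 = 1 := by
  have h : Finset.Nat.antidiagonalTuple (k : ℕ) 0 = {0} :=
    Finset.Nat.antidiagonalTuple_zero_right _
  simp [rootSum, h, hf]

theorem isPrimitiveRoot_rho_sq (k : ℕ+) : IsPrimitiveRoot (MZV.rho k ^ 2) k := by
  have := Complex.isPrimitiveRoot_exp k k.ne_zero
  rwa [show MZV.rho k ^ 2 = Complex.exp (2 * Real.pi * Complex.I / (k : ℕ)) by
    rw [MZV.rho, ← Complex.exp_nat_mul]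
    congr 1
    push_cast
    ring]

theorem sum_rho_pow (k : ℕ+) (i : ℕ) :
    ∑ j : Fin (k : ℕ), ((MZV.rho k ^ 2) ^ (j : ℕ)) ^ i = if (k : ℕ) ∣ i then ((k : ℕ) : ℂ) else 0 := by
  have h := isPrimitiveRoot_rho_sq k
  simp only [fun j => pow_right_comm (MZV.rho k ^ 2) j i]
  rw [Fin.sum_univ_eq_sum_range fun j => ((MZV.rho k ^ 2) ^ i) ^ j]
  split_ifs with hi
  · simp [h.pow_eq_one_iff_dvd i |>.2 hi]
  · have h1 : (MZV.rho k ^ 2) ^ i ≠ 1 := fun h1 => hi ((h.pow_eq_one_iff_dvd i).1 h1)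
    rw [geom_sum_eq h1, ← pow_mul, mul_comm i, pow_mul, h.pow_eq_one]
    simp

/-- Orthogonality of roots of unity: averaging over ρ_k^{2j} projects onto exponents divisible by k.
-/
theorem sum_rescale_eq_expand (g : ℚ⟦X⟧) (k : ℕ+) :
    ∑ j : Fin (k : ℕ), rescale ((MZV.rho k ^ 2) ^ (j : ℕ)) (PowerSeries.map (algebraMap ℚ ℂ) g)
      = expand k k.ne_zero (PowerSeries.mk fun m => ((k : ℕ) : ℂ) * (coeff (k * m) g : ℚ)) := by
  ext i
  rw [map_sum]
  simp only [coeff_rescale]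
  rw [← Finset.sum_mul, sum_rho_pow, coeff_expand]
  split_ifs with hi
  · obtain ⟨m, rfl⟩ := hi
    simp
  · simp

theorem coeff_mul_expand_mul (k n : ℕ) (hk : k ≠ 0) (h P : ℂ⟦X⟧) :
    coeff (k * n) (expand k hk h * P)
      = ∑ m ∈ range (n + 1), coeff m h * coeff (k * (n - m)) P := by
  rw [coeff_mul, Finset.Nat.sum_antidiagonal_eq_sum_range_succ
    fun i j => coeff i (expand k hk h) * coeff j P]
  symm
  refine Finset.sum_of_injOn (fun m => k * m) ?_ ?_ ?_ ?_
  · intro a _ b _ hab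
    exact Nat.eq_of_mul_eq_mul_left (Nat.pos_of_ne_zero hk) hab
  · intro m hm
    simp only [coe_range, Set.mem_Iio, Nat.lt_succ_iff] at hm ⊢
    exact Nat.mul_le_mul_left k hm
  · intro i hi hi'
    rw [coeff_expand_of_not_dvd, zero_mul]
    rintro ⟨m, rfl⟩
    simp only [mem_range, Nat.lt_succ_iff] at hi
    refine hi' ⟨m, ?_, rfl⟩
    simpa [Nat.lt_succ_iff] using Nat.le_of_mul_le_mul_left hi (Nat.pos_of_ne_zero hk)
  · intro m _
    simp only [coeff_expand_mul, Nat.mul_sub]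

/-- For P = ∏_j f(ρ_k^{2j} T), the logarithmic derivative T P'/P is the sum of the g(ρ_k^{2j} T), a
series in T^k. Comparing coefficients of T^{k(n+1)} and dividing by k gives the recursion. -/
theorem rootSum_newton {f g : ℚ⟦X⟧} (hfg : X * d⁄dX ℚ f = g * f) (hg : coeff 0 g = 0) (k : ℕ+)
    (n : ℕ) : ((n + 1 : ℕ) : ℂ) * rootSum f k ((n + 1) * k)
      = ∑ i ∈ range (n + 1), ((coeff (k * (i + 1)) g : ℚ) : ℂ) * rootSum f k ((n - i) * k) := by
  have hres : ∀ (a : ℂ) (φ : ℂ⟦X⟧), X * d⁄dX ℂ (rescale a φ) = rescale a (X * d⁄dX ℂ φ) := by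
    intro a φ
    ext m
    cases m with
    | zero => simp
    | succ m =>
      simp only [coeff_succ_X_mul, coeff_derivative, coeff_rescale]
      ring
  have hmap : X * d⁄dX ℂ (PowerSeries.map (algebraMap ℚ ℂ) f)
      = PowerSeries.map (algebraMap ℚ ℂ) g * PowerSeries.map (algebraMap ℚ ℂ) f := by
    rw [← map_mul, ← hfg]
    ext m
    cases m with
    | zero => simp
    | succ m => simp [coeff_succ_X_mul, coeff_derivative]
  have h := PowerSeries.X_mul_derivative_prod (univ : Finset (Fin (k : ℕ)))
    (fun j => rescale ((MZV.rho k ^ 2) ^ (j : ℕ)) (PowerSeries.map (algebraMap ℚ ℂ) f))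
    (fun j => rescale ((MZV.rho k ^ 2) ^ (j : ℕ)) (PowerSeries.map (algebraMap ℚ ℂ) g))
    (fun j _ => by rw [hres, hmap, map_mul])
  rw [sum_rescale_eq_expand] at h
  have h1 := congrArg (coeff (k * (n + 1))) h
  rw [coeff_mul_expand_mul] at h1
  obtain ⟨q, hq⟩ : ∃ q, (k : ℕ) * (n + 1) = q + 1 :=
    ⟨_, Nat.succ_pred_eq_of_pos (Nat.mul_pos k.pos n.succ_pos) |>.symm⟩
  have h2 : ∀ φ : ℂ⟦X⟧, coeff (k * (n + 1)) (X * d⁄dX ℂ φ)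
      = (k : ℕ) * (n + 1 : ℕ) * coeff (k * (n + 1)) φ := by
    intro φ
    have hq' : ((k : ℕ) : ℂ) * ((n + 1 : ℕ) : ℂ) = (q : ℂ) + 1 := by exact_mod_cast hq
    rw [hq', hq, coeff_succ_X_mul, coeff_derivative, mul_comm]
  -- The split-off term m = 0 carries the coefficient being computed; it drops out since g has no
  -- constant term.
  rw [h2, Finset.sum_range_succ'] at h1
  simp only [coeff_prod_rescale, coeff_mk, mul_zero, hg, Rat.cast_zero, zero_mul, add_zero,
    Nat.succ_sub_succ_eq_sub, mul_assoc] at h1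
  rw [← Finset.mul_sum] at h1
  have hk : ((k : ℕ) : ℂ) ≠ 0 := Nat.cast_ne_zero.2 k.ne_zero
  simpa only [mul_comm (k : ℕ)] using mul_left_cancel₀ hk h1

theorem coeff_eq_rootSum (k : ℕ+) (n : ℕ) :
    MZV.coeff k n = (-1) ^ n * rootSum sinhSeries k (n * k) := by
  rw [MZV.coeff, rootSum]
  congr 1
  refine Finset.sum_congr rfl fun ν _ => ?_
  rw [div_eq_mul_inv, mul_comm, ← Finset.prod_inv_distrib]
  congr 1
  refine Finset.prod_congr rfl fun j _ => ?_
  simp [sinhSeries]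

theorem coeffStar_eq_rootSum (k : ℕ+) (n : ℕ) :
    MZV.coeffStar k n = rootSum sinhSeries⁻¹ k (n * k) := by
  rw [MZV.coeffStar, rootSum]
  refine Finset.sum_congr rfl fun ν _ => ?_
  congr 1
  refine Finset.prod_congr rfl fun j _ => ?_
  simp [sinhSeries_inv]

theorem coeff_zero_right (k : ℕ+) : MZV.coeff k 0 = 1 := by
  simp [coeff_eq_rootSum, rootSum_zero _ constantCoeff_sinhSeries]

theorem coeffStar_zero_right (k : ℕ+) : MZV.coeffStar k 0 = 1 := by
  rw [coeffStar_eq_rootSum, zero_mul, rootSum_zero]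
  simp [constantCoeff_sinhSeries]

/-- The factor (-1)^n in c_{k,n} and the minus sign in T F'/F = -G combine to the sign (-1)^i of the
identity for elementary symmetric functions. -/
theorem coeff_newton (k : ℕ+) (n : ℕ) : ((n + 1 : ℕ) : ℂ) * MZV.coeff k (n + 1)
    = ∑ i ∈ range (n + 1),
      (((-1) ^ (i + 1 + 1) * evenZetaCoeff (k * (i + 1)) : ℚ) : ℂ) * MZV.coeff k (n - i) := by
  simp only [coeff_eq_rootSum]
  rw [mul_left_comm, rootSum_newton (g := -evenZetaSeries) X_mul_derivative_sinhSeries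
    (by simpa [evenZetaCoeff] using evenZetaCoeff_zero), Finset.mul_sum]
  refine Finset.sum_congr rfl fun i hi => ?_
  obtain ⟨m, rfl⟩ : ∃ m, n = i + m := ⟨n - i, by have := mem_range.1 hi; omega⟩
  rw [Nat.add_sub_cancel_left]
  simp only [evenZetaCoeff, map_neg]
  push_cast
  ring

theorem coeffStar_newton (k : ℕ+) (n : ℕ) : ((n + 1 : ℕ) : ℂ) * MZV.coeffStar k (n + 1)
    = ∑ i ∈ range (n + 1), (evenZetaCoeff (k * (i + 1)) : ℂ) * MZV.coeffStar k (n - i) := by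
  simp only [coeffStar_eq_rootSum]
  exact rootSum_newton X_mul_derivative_sinhSeries_inv evenZetaCoeff_zero k n

end Roots

/-! ### Closed form of c_{2,n} -/

section CoeffTwo

open Finset

theorem rho_two : MZV.rho 2 = Complex.I := by
  rw [MZV.rho, show (Real.pi * Complex.I / ((2 : ℕ+) : ℕ) : ℂ) = Real.pi / 2 * Complex.I by
    push_cast; ring]
  exact Complex.exp_pi_div_two_mul_I

theorem sum_range_two_mul {M : Type*} [AddCommMonoid M] (f : ℕ → M) (n : ℕ) :
    ∑ i ∈ range (2 * n), f i = ∑ i ∈ range n, (f (2 * i) + f (2 * i + 1)) := by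
  induction n with
  | zero => simp
  | succ n ih => rw [mul_add, mul_one, sum_range_succ, sum_range_succ, ih, sum_range_succ, add_assoc]

/-- The imaginary part of (1 + i)^{4n+2} = (-4)^n · 2i, expanded by the binomial theorem. -/
theorem sum_neg_one_pow_choose (n : ℕ) :
    ∑ i ∈ range (2 * n + 1), (-1 : ℝ) ^ i * ((4 * n + 2).choose (2 * i + 1) : ℝ)
      = 2 * (-4) ^ n := by
  have h : (1 + Complex.I) ^ (4 * n + 2) = ((-4 : ℝ) ^ n : ℝ) * (2 * Complex.I) := by
    rw [pow_add, pow_mul]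
    have h2 : (1 + Complex.I) ^ 2 = 2 * Complex.I := by
      linear_combination Complex.I_sq
    have h4 : (1 + Complex.I) ^ 4 = -4 := by
      rw [show (4 : ℕ) = 2 * 2 from rfl, pow_mul, h2]
      linear_combination 4 * Complex.I_sq
    rw [h2, h4]
    push_cast
    ring
  rw [add_comm 1, add_pow, sum_range_succ,
    show 4 * n + 2 = 2 * (2 * n + 1) by ring, sum_range_two_mul] at h
  have h1 := congrArg Complex.im h
  have e : ∀ i : ℕ, Complex.I ^ (2 * i) = ((-1 : ℝ) ^ i : ℝ) := by
    intro i
    rw [pow_mul, Complex.I_sq]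
    push_cast
    rfl
  simp only [one_pow, mul_one, e, pow_succ, Complex.add_im, Complex.im_sum] at h1
  rw [show 4 * n + 2 = 2 * (2 * n + 1) by ring]
  simpa [mul_comm, ← Complex.ofReal_natCast, ← Complex.ofReal_mul, -Complex.ofReal_pow,
    -Complex.ofReal_neg, -Complex.ofReal_natCast] using h1

theorem coeff_two (n : ℕ) : MZV.coeff 2 n = 2 * 4 ^ n / ((4 * n + 2).factorial : ℂ) := by
  rw [MZV.coeff, show n * ((2 : ℕ+) : ℕ) = 2 * n by simp [mul_comm]]
  change (-1) ^ n * ∑ ν ∈ Finset.Nat.antidiagonalTuple 2 (2 * n),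
    MZV.rho 2 ^ (∑ j : Fin 2, 2 * (j : ℕ) * ν j) / ∏ j : Fin 2, ((2 * ν j + 1).factorial : ℂ) = _
  have hf : ((4 * n + 2).factorial : ℂ) ≠ 0 := Nat.cast_ne_zero.2 (Nat.factorial_ne_zero _)
  rw [Finset.Nat.antidiagonalTuple_two, Finset.sum_map, rho_two, eq_div_iff hf, mul_assoc,
    Finset.sum_mul]
  have h := congrArg (fun x : ℝ => (x : ℂ)) (sum_neg_one_pow_choose n)
  push_cast at h
  have hsum : ∑ i ∈ range (2 * n + 1), (-1 : ℂ) ^ i * ((4 * n + 2).choose (2 * i + 1) : ℂ)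
      = ∑ p ∈ antidiagonal (2 * n), (-1 : ℂ) ^ p.1 * ((4 * n + 2).choose (2 * p.1 + 1) : ℂ) :=
    (Finset.Nat.sum_antidiagonal_eq_sum_range_succ
      (fun i _ => (-1 : ℂ) ^ i * ((4 * n + 2).choose (2 * i + 1) : ℂ)) (2 * n)).symm
  rw [hsum] at h
  trans (-1) ^ n * (2 * (-4) ^ n)
  · rw [← h]
    congr 1
    refine Finset.sum_congr rfl fun p hp => ?_
    obtain ⟨a, b⟩ := p
    have hab : a + b = 2 * n := by simpa using hp
    -- Since ρ_2 = i, the sign is attached to the second index; a + b is even, so it may be moved to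
    -- the first.
    have hpar : (-1 : ℂ) ^ b = (-1) ^ a := by
      have : (-1 : ℂ) ^ a * (-1) ^ b = 1 := by rw [← pow_add, hab, pow_mul]; simp
      rcases neg_one_pow_eq_or ℂ a with ha | ha <;> rw [ha] at this ⊢
      · linear_combination this
      · linear_combination -this
    have hn : 4 * n + 2 = (2 * a + 1) + (2 * b + 1) := by omega
    have ha : ((2 * a + 1).factorial : ℂ) ≠ 0 := Nat.cast_ne_zero.2 (Nat.factorial_ne_zero _)
    have hb : ((2 * b + 1).factorial : ℂ) ≠ 0 := Nat.cast_ne_zero.2 (Nat.factorial_ne_zero _)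
    rw [hn, Nat.cast_add_choose ℂ]
    simp [Fin.sum_univ_two, Fin.prod_univ_two, pow_mul, Complex.I_sq, hpar]
    ring
  · rw [neg_pow 4 n, mul_left_comm, mul_left_comm ((-1 : ℂ) ^ n), ← mul_assoc ((-1 : ℂ) ^ n),
      ← mul_pow]
    norm_num

end CoeffTwo

end MZVSeries

namespace MZV

open Finset

variable {K : Type*} [Field K] {R : Type*} [CommRing R] [Algebra K R]

/-! ### Extension of `Z` to `𝔥` -/

/-- A `K`-linear extension to `𝔥` of a map satisfying the regularized double shuffle relations. -/
structure IsExtension (Z : h0 K →ₗ[K] R) (E : H K →ₗ[K] R) : Prop where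
  apply_mk : ∀ (w : H K) (hw : w ∈ h0 K), Z ⟨w, hw⟩ = E w

/-- The extension is an arbitrary linear one, with no multiplicativity outside 𝔥⁰. It lets words
such as y z_b be evaluated in intermediate formulas, where their values cancel. -/
theorem exists_isExtension (Z : h0 K →ₗ[K] R) : ∃ E : H K →ₗ[K] R, IsExtension Z E := by
  obtain ⟨E, hE⟩ := LinearMap.exists_extend Z
  exact ⟨E, ⟨fun w hw => (LinearMap.congr_fun hE ⟨w, hw⟩).symm⟩⟩

section Extension

variable {Z : h0 K →ₗ[K] R} {E : H K →ₗ[K] R}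

theorem IsExtension.map_one (hE : IsExtension Z E) (hZ : RegularizedDoubleShuffle Z) :
    E 1 = 1 := by
  rw [← hE.apply_mk 1 (one_mem_h0 K), hZ.map_one]

theorem IsExtension.map_shuffle (hE : IsExtension Z E) (hZ : RegularizedDoubleShuffle Z)
    {u v : H K} (hu : u ∈ h0 K) (hv : v ∈ h0 K) : E (shuffle K u v) = E u * E v := by
  rw [← hE.apply_mk u hu, ← hE.apply_mk v hv, ← hZ.map_shuffle, shuffle0, hE.apply_mk]

theorem IsExtension.map_stuffle (hE : IsExtension Z E) (hZ : RegularizedDoubleShuffle Z)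
    {u v : H K} (hu : u ∈ h0 K) (hv : v ∈ h0 K) : E (stuffle K u v) = E u * E v := by
  rw [← hE.apply_mk u hu, ← hE.apply_mk v hv, ← hZ.map_stuffle, stuffle0, hE.apply_mk]

theorem shuffle_one_right (w : H K) : shuffle K w 1 = w := by
  have h : (shuffle K).flip 1 = LinearMap.id := by
    refine (wordBasis K).ext fun u => ?_
    rw [LinearMap.flip_apply, wordBasis_apply, ← word_nil, shuffle_word, shuffleWord_nil_right,
      LinearMap.id_apply]
  exact LinearMap.congr_fun h w

/-- Hoffman's relation. -/
theorem IsExtension.map_shuffle_sub_stuffle (hE : IsExtension Z E)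
    (hZ : RegularizedDoubleShuffle Z) {u v : H K} (hu : u ∈ h1 K) (hv : v ∈ h0 K)
    (h : shuffle K u v - stuffle K u v ∈ h0 K) : E (shuffle K u v - stuffle K u v) = 0 := by
  rw [← hE.apply_mk _ h]
  -- An element of 𝔥⁰ is its own regularization: only the term with y^{⧢0} = 1 occurs.
  refine hZ.map_reg u hu v hv _ ⟨Finsupp.single 0 ⟨_, h⟩, ?_, by simp⟩
  rw [Finsupp.sum_single_index (by simp), shufflePowY, shuffle_one_right]

end Extension

/-! ### Depth two -/

section DepthTwo

variable (K)

theorem z_succPNat (a : ℕ) : z K a.succPNat = X K ^ a * Y K := by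
  simp [z]

theorem X_pow_mul_z (m k : ℕ+) : X K ^ (m : ℕ) * z K k = z K (k + m) := by
  rw [z, z, ← mul_assoc, ← pow_add]
  congr 2
  have := k.pos
  rw [PNat.add_coe]
  omega

theorem z_mem_h0 (k : ℕ+) (hk : 2 ≤ k) : z K k ∈ h0 K := by
  have := z_mul_mem_h0 K k hk (one_mem_h1 K)
  rwa [mul_one] at this

theorem word_replicate_append (a : ℕ) :
    word K (List.replicate a Letter.x ++ [Letter.y]) = z K a.succPNat := by
  simp [z_succPNat, word, X, Y]

/-- The shuffle product `z_{a+1} ⧢ z_{b+1}`. -/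
theorem shuffle_z_z (a b : ℕ) :
    shuffle K (z K a.succPNat) (z K b.succPNat)
      = (if a = 0 then Y K * z K b.succPNat
          else X K * shuffle K (z K (a - 1).succPNat) (z K b.succPNat))
        + (if b = 0 then Y K * z K a.succPNat
          else X K * shuffle K (z K a.succPNat) (z K (b - 1).succPNat)) := by
  simp only [← word_replicate_append, shuffle_word]
  cases a with
  | zero =>
    cases b with
    | zero => simp [shuffleWord, Y]
    | succ b =>
      simp [List.replicate_succ, shuffleWord, X, Y]
  | succ a =>
    cases b with
    | zero =>
      simp only [List.replicate_succ, List.cons_append, List.replicate_zero, List.nil_append]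
      rw [shuffleWord, shuffleWord_nil_right]
      simp [X, Y]
    | succ b =>
      simp only [List.replicate_succ, List.cons_append]
      rw [shuffleWord]
      simp [X]

theorem shuffle_z_Y (a : ℕ) :
    shuffle K (z K a.succPNat) (z K (0 : ℕ).succPNat)
      = shuffle K (z K (0 : ℕ).succPNat) (z K a.succPNat) := by
  induction a with
  | zero => rfl
  | succ a ih =>
    rw [shuffle_z_z K (a + 1) 0, shuffle_z_z K 0 (a + 1)]
    simp [ih, add_comm]

/-- The letter y is inserted at each place of x^b y; the last two insertions coincide in position
class and give the extra word z_{b+1} y. -/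
theorem shuffle_Y_z (b : ℕ) :
    shuffle K (z K (0 : ℕ).succPNat) (z K b.succPNat)
      = (∑ p ∈ antidiagonal b, z K p.1.succPNat * z K p.2.succPNat)
        + z K b.succPNat * z K (0 : ℕ).succPNat := by
  induction b with
  | zero =>
    rw [shuffle_z_z K 0 0]
    simp [z_succPNat]
  | succ b ih =>
    rw [shuffle_z_z K 0 (b + 1), Finset.Nat.sum_antidiagonal_succ, if_pos rfl,
      if_neg b.succ_ne_zero, Nat.add_sub_cancel, ih]
    simp [mul_add, Finset.mul_sum, z_succPNat, pow_succ', mul_assoc, add_assoc]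

/-- Telescoping: x (z_a ⧢ z_{b+1}) arises from the neighbouring pairs (a, b) and (a - 1, b + 1) with
opposite signs, so only the boundary words starting with y survive. -/
theorem sum_neg_one_pow_shuffle (N : ℕ) :
    ∑ p ∈ antidiagonal N, (-1 : K) ^ p.1 • shuffle K (z K p.1.succPNat) (z K p.2.succPNat)
      = (1 + (-1 : K) ^ N) • (Y K * z K N.succPNat) := by
  cases N with
  | zero => simp [shuffle_z_z K 0 0, add_smul]
  | succ N =>
    have h : ∀ p : ℕ × ℕ, (-1 : K) ^ p.1 • shuffle K (z K p.1.succPNat) (z K p.2.succPNat)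
        = (-1 : K) ^ p.1 • (if p.1 = 0 then Y K * z K p.2.succPNat
          else X K * shuffle K (z K (p.1 - 1).succPNat) (z K p.2.succPNat))
        + (-1 : K) ^ p.1 • (if p.2 = 0 then Y K * z K p.1.succPNat
          else X K * shuffle K (z K p.1.succPNat) (z K (p.2 - 1).succPNat)) := fun p => by
      rw [← smul_add, ← shuffle_z_z]
    rw [Finset.sum_congr rfl fun p _ => h p, Finset.sum_add_distrib,
      Finset.Nat.sum_antidiagonal_succ, Finset.Nat.sum_antidiagonal_succ']
    simp [pow_succ, add_smul]
    abel

theorem stuffle_z_zWord_cons (k l : ℕ+) (v : List ℕ+) :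
    stuffle K (z K k) (zWord K (l :: v)) = z K k * zWord K (l :: v)
      + z K l * stuffle K (z K k) (zWord K v) + z K (k + l) * zWord K v := by
  have h : z K k = zWord K [k] := by simp
  conv_lhs => rw [h]
  conv_rhs => rw [h]
  rw [stuffle_zWord, stuffle_zWord, stuffleIndex, stuffleIndex, stuffleIndex]
  simp

theorem stuffle_one_right (k : ℕ+) : stuffle K (z K k) 1 = z K k := by
  have h : z K k = zWord K [k] := by simp
  rw [h, ← zWord_nil, stuffle_zWord, stuffleIndex]

theorem stuffle_z_z (k l : ℕ+) : stuffle K (z K k) (z K l)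
    = z K k * z K l + z K l * z K k + z K (k + l) := by
  simpa [stuffle_one_right] using stuffle_z_zWord_cons K k l []

/-- Both products contain the word y z_{b+2} exactly once, and all their other words start with x.
Thus no regularization is needed. -/
theorem shuffle_sub_stuffle_Y_z_mem_h0 (b : ℕ) :
    shuffle K (z K (0 : ℕ).succPNat) (z K (b + 1).succPNat)
      - stuffle K (z K (0 : ℕ).succPNat) (z K (b + 1).succPNat) ∈ h0 K := by
  obtain ⟨w, hw⟩ := shuffleWord_append_y K [] (List.replicate b Letter.x)
  have hw' : shuffle K (z K (0 : ℕ).succPNat) (z K b.succPNat) = w * Y K := by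
    rw [← hw, ← word_replicate_append, ← word_replicate_append, shuffle_word]
    simp
  have h2 : (2 : ℕ+) ≤ (b + 1).succPNat := by
    rw [← PNat.coe_le_coe]
    simp
  have h : shuffle K (z K (0 : ℕ).succPNat) (z K (b + 1).succPNat)
      - stuffle K (z K (0 : ℕ).succPNat) (z K (b + 1).succPNat)
      = X K * (w * Y K) - z K (b + 1).succPNat * z K (0 : ℕ).succPNat
        - z K ((0 : ℕ).succPNat + (b + 1).succPNat) := by
    rw [shuffle_z_z, stuffle_z_z, if_pos rfl, if_neg b.succ_ne_zero, Nat.add_sub_cancel, hw',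
      z_succPNat K 0, pow_zero, one_mul]
    abel
  rw [h]
  refine Submodule.sub_mem _ (Submodule.sub_mem _ (X_mul_mul_Y_mem_h0 K w) ?_) (z_mem_h0 K _ ?_)
  · exact z_mul_mem_h0 K _ h2 (by simpa using zWord_mem_h1 K [(0 : ℕ).succPNat])
  · exact h2.trans (PNat.lt_add_left _ _).le

end DepthTwo

theorem sum_antidiagonal_odd {M : Type*} [AddCommGroup M] (f : ℕ → ℕ → M) (n : ℕ) :
    ∑ p ∈ antidiagonal (2 * n + 2), (f p.1 p.2 - (-1 : ℤ) ^ p.1 • f p.1 p.2)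
      = 2 • ∑ i ∈ range (n + 1), f (2 * i + 1) (2 * (n - i) + 1) := by
  rw [Finset.Nat.sum_antidiagonal_eq_sum_range_succ
    fun i j => f i j - (-1 : ℤ) ^ i • f i j, Finset.sum_range_succ,
    show 2 * n + 2 = 2 * (n + 1) by ring, MZVSeries.sum_range_two_mul, Finset.smul_sum]
  simp only [pow_mul, pow_succ]
  simp only [pow_zero, one_mul, neg_mul_neg, one_pow, one_smul, sub_self, zero_add, add_zero,
    neg_smul, sub_neg_eq_add, two_smul]
  refine Finset.sum_congr rfl fun i hi => ?_
  have : 2 * (n + 1) - (2 * i + 1) = 2 * (n - i) + 1 := by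
    have := mem_range.1 hi
    omega
  rw [this]

/-! ### Euler's evaluation of even zeta values from double shuffle relations -/

section EvenZeta

variable {Z : h0 K →ₗ[K] R} {E : H K →ₗ[K] R}

theorem IsExtension.map_shuffle_z_z (hE : IsExtension Z E) (hZ : RegularizedDoubleShuffle Z)
    (a b : ℕ) (hab : a + b ≠ 0) : E (shuffle K (z K a.succPNat) (z K b.succPNat))
      = E (stuffle K (z K a.succPNat) (z K b.succPNat)) := by
  have h2 : ∀ b : ℕ, z K (b + 1).succPNat ∈ h0 K := fun b =>
    z_mem_h0 K _ (by rw [← PNat.coe_le_coe]; simp)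
  have h0 : ∀ b : ℕ, E (shuffle K (z K (0 : ℕ).succPNat) (z K (b + 1).succPNat))
      = E (stuffle K (z K (0 : ℕ).succPNat) (z K (b + 1).succPNat)) := fun b => by
    rw [← sub_eq_zero, ← map_sub]
    exact hE.map_shuffle_sub_stuffle hZ (by simpa using zWord_mem_h1 K [(0 : ℕ).succPNat]) (h2 b)
      (shuffle_sub_stuffle_Y_z_mem_h0 K b)
  rcases a with _ | a
  · rcases b with _ | b
    · exact absurd rfl hab
    · exact h0 b
  · rcases b with _ | b
    -- Hoffman's relation has y on the left; both products are symmetric here.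
    · rw [shuffle_z_Y, h0, stuffle_z_z, stuffle_z_z, add_comm (0 : ℕ).succPNat,
        add_comm (z K (0 : ℕ).succPNat * _)]
    · rw [hE.map_shuffle hZ (h2 a) (h2 b), hE.map_stuffle hZ (h2 a) (h2 b)]

/-- The recursion `∑_{i=1}^{n-1} ζ(2i) ζ(2n-2i) = (n + 1/2) ζ(2n)`. -/
theorem IsExtension.sum_even_mul_even (hE : IsExtension Z E) (hZ : RegularizedDoubleShuffle Z)
    (n : ℕ) :
    2 * ∑ i ∈ range (n + 1),
        E (z K (2 * i + 1).succPNat) * E (z K (2 * (n - i) + 1).succPNat)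
      = (2 * n + 5) * E (z K (2 * n + 3).succPNat) := by
  have hadd : ∀ a b : ℕ, a.succPNat + b.succPNat = (a + b + 1).succPNat := fun a b =>
    PNat.coe_injective (by simp; omega)
  set N := 2 * n + 2 with hN
  -- The value f 0 N, of the word y z_{N+1}, depends on the choice of E. It occurs equally in the
  -- plain and the alternating sum and cancels in their difference.
  set f : ℕ → ℕ → R := fun a b => E (z K a.succPNat * z K b.succPNat) with hf
  set ζ := E (z K (2 * n + 3).succPNat) with hζ
  have hstuffle : ∀ a b : ℕ, a + b = N →
      E (stuffle K (z K a.succPNat) (z K b.succPNat)) = f a b + f b a + ζ := by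
    intro a b hab
    rw [stuffle_z_z, map_add, map_add, hadd, hab]
  have hNe : (-1 : ℤ) ^ N = 1 := (show Even N by use n + 1; omega).neg_one_pow
  -- the sum formula
  have h1 : ∑ p ∈ antidiagonal N, f p.1 p.2 = f 0 N + ζ := by
    have h := hE.map_shuffle_z_z hZ 0 N (by omega)
    rw [hstuffle 0 N (by omega), shuffle_Y_z, map_add, map_sum] at h
    linear_combination h
  -- the alternating sum formula
  have h2 : 2 * ∑ p ∈ antidiagonal N, (-1 : ℤ) ^ p.1 • f p.1 p.2 = 2 * f 0 N - ζ := by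
    have h := congrArg E (sum_neg_one_pow_shuffle K N)
    have hK : ∀ i : ℕ, (-1 : K) ^ i = ((-1 : ℤ) ^ i : ℤ) := fun i => by push_cast; rfl
    simp only [hK, hNe, map_sum, map_smul] at h
    have hR : ∀ (i : ℤ) (r : R), (i : K) • r = i • r := fun i r => by
      rw [Int.cast_smul_eq_zsmul]
    simp only [hR] at h
    have hsw : ∑ p ∈ antidiagonal N, (-1 : ℤ) ^ p.1 • f p.2 p.1
        = ∑ p ∈ antidiagonal N, (-1 : ℤ) ^ p.1 • f p.1 p.2 := by
      rw [← Finset.Nat.sum_antidiagonal_swap]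
      refine Finset.sum_congr rfl fun p hp => ?_
      have hp' : p.1 + p.2 = N := by simpa using hp
      have : (-1 : ℤ) ^ p.2 = (-1) ^ p.1 := by
        have h3 : (-1 : ℤ) ^ p.1 * (-1) ^ p.2 = 1 := by rw [← pow_add, hp', hNe]
        rcases neg_one_pow_eq_or ℤ p.1 with h4 | h4 <;> rw [h4] at h3 ⊢ <;> omega
      simp [this]
    have hone : ∑ p ∈ antidiagonal N, (-1 : ℤ) ^ p.1 = 1 := by
      rw [Finset.Nat.sum_antidiagonal_eq_sum_range_succ fun i _ => (-1 : ℤ) ^ i,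
        Finset.sum_range_succ, hNe, hN, show 2 * n + 2 = 2 * (n + 1) by ring,
        MZVSeries.sum_range_two_mul]
      simp [pow_succ]
    have hterm : ∀ p ∈ antidiagonal N,
        (-1 : ℤ) ^ p.1 • E (shuffle K (z K p.1.succPNat) (z K p.2.succPNat))
          = (-1 : ℤ) ^ p.1 • f p.1 p.2 + (-1 : ℤ) ^ p.1 • f p.2 p.1 + (-1 : ℤ) ^ p.1 • ζ := by
      intro p hp
      have hp' : p.1 + p.2 = N := by simpa using hp
      rw [hE.map_shuffle_z_z hZ _ _ (by omega), hstuffle _ _ hp', smul_add, smul_add]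
    rw [Finset.sum_congr rfl hterm, Finset.sum_add_distrib, Finset.sum_add_distrib, hsw,
      ← Finset.sum_smul, hone, one_smul] at h
    have h5 : ((1 : K) + ((1 : ℤ) : K)) • E (Y K * z K N.succPNat) = 2 * f 0 N := by
      simp only [hf]
      rw [z_succPNat K 0, Int.cast_one, add_smul, one_smul, two_mul, pow_zero, one_mul]
    rw [h5] at h
    linear_combination h
  have h3 := sum_antidiagonal_odd f n
  rw [Finset.sum_sub_distrib, h1] at h3
  -- products in terms of double zeta values
  have h4 : ∀ i ∈ range (n + 1),
      E (z K (2 * i + 1).succPNat) * E (z K (2 * (n - i) + 1).succPNat)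
        = f (2 * i + 1) (2 * (n - i) + 1) + f (2 * (n - i) + 1) (2 * i + 1) + ζ := by
    intro i hi
    have := mem_range.1 hi
    have hm : ∀ b : ℕ, z K (2 * b + 1).succPNat ∈ h0 K := fun b =>
      z_mem_h0 K _ (by rw [← PNat.coe_le_coe]; simp)
    rw [← hE.map_stuffle hZ (hm i) (hm (n - i)), hstuffle _ _ (by omega)]
  have h5 : ∑ i ∈ range (n + 1), f (2 * (n - i) + 1) (2 * i + 1)
      = ∑ i ∈ range (n + 1), f (2 * i + 1) (2 * (n - i) + 1) := by
    rw [← Finset.sum_range_reflect]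
    refine Finset.sum_congr rfl fun i hi => ?_
    have := mem_range.1 hi
    congr 2
    omega
  rw [Finset.sum_congr rfl h4, Finset.sum_add_distrib, Finset.sum_add_distrib, h5]
  rw [Finset.sum_const, card_range]
  simp only [nsmul_eq_mul] at h3 ⊢
  push_cast at h3 ⊢
  -- The sum formula minus the alternating one makes twice the sum of f over odd pairs equal to
  -- 3ζ/2. The n + 1 stuffle products add (n + 1)ζ, whence n + 5/2 in total.
  linear_combination -2 * h3 - h2

/-- Euler's formula for the even zeta values. -/
theorem IsExtension.map_z_even [CharZero K] (hE : IsExtension Z E)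
    (hZ : RegularizedDoubleShuffle Z) (n : ℕ) :
    E (z K (2 * n + 1).succPNat)
      = (MZVSeries.evenZetaCoeff (n + 1) : K) • (-6 * E (z K 2)) ^ (n + 1) := by
  induction n using Nat.strong_induction_on with
  | _ n ih =>
    cases n with
    | zero =>
      rw [MZVSeries.evenZetaCoeff_one]
      have : ((2 * 0 + 1 : ℕ).succPNat) = 2 := rfl
      rw [this, zero_add, pow_one, neg_mul, Algebra.smul_def]
      have h6 : (6 : R) = algebraMap K R 6 := (map_ofNat (algebraMap K R) 6).symm
      rw [h6, mul_neg, ← mul_assoc, ← map_mul]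
      norm_num
    | succ n =>
      have h := hE.sum_even_mul_even hZ n
      have hb := congrArg (Rat.cast : ℚ → K) (MZVSeries.evenZetaCoeff_add_two n)
      push_cast at hb
      have h0 : (2 * n + 5 : K) ≠ 0 := by exact_mod_cast (2 * n + 4).succ_ne_zero
      apply smul_right_injective R h0
      change (2 * n + 5 : K) • _ = (2 * n + 5 : K) • _
      rw [smul_smul, hb, mul_smul, Finset.sum_smul]
      have hl : (2 * n + 5 : K) • E (z K (2 * (n + 1) + 1).succPNat)
          = (2 * n + 5) * E (z K (2 * n + 3).succPNat) := by
        rw [Algebra.smul_def, map_add, map_mul, map_natCast, map_ofNat (algebraMap K R) 2,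
          map_ofNat (algebraMap K R) 5]
        rfl
      rw [hl, ← h, Algebra.smul_def, map_ofNat]
      congr 1
      refine Finset.sum_congr rfl fun i hi => ?_
      have hi' := mem_range.1 hi
      rw [ih i (by omega), ih (n - i) (by omega), smul_mul_smul_comm, ← pow_add,
        show n - i + 1 = n + 1 - i by omega]
      congr 2
      omega

end EvenZeta

end MZV

namespace MZV

open Finset

/-! ### Newton identities in the stuffle algebra -/

section Newton

variable (K : Type*) [Field K]

theorem stuffle_z_mul (k l : ℕ+) (v : List ℕ+) :
    stuffle K (z K k) (z K l * zWord K v) = z K k * (z K l * zWord K v)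
      + z K l * stuffle K (z K k) (zWord K v) + z K (k + l) * zWord K v := by
  rw [← zWord_cons, stuffle_z_zWord_cons]

theorem zWord_replicate (m : ℕ+) (n : ℕ) : zWord K (List.replicate n m) = z K m ^ n := by
  simp [zWord]

theorem z_succPNat_add_mul (m : ℕ+) (i : ℕ) :
    z K (i.succPNat * m + m) = z K ((i + 1).succPNat * m) := by
  congr 1
  apply PNat.coe_injective
  simp
  ring

/-- The sum of the words with one letter `z_{(i+1)m}` and `n` letters `z_m`. -/
noncomputable def insertSum (m : ℕ+) (i n : ℕ) : H K :=
  ∑ j ∈ range (n + 1), z K m ^ j * z K (i.succPNat * m) * z K m ^ (n - j)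

theorem insertSum_zero_right (m : ℕ+) (i : ℕ) : insertSum K m i 0 = z K (i.succPNat * m) := by
  simp [insertSum]

theorem insertSum_succ (m : ℕ+) (i n : ℕ) : insertSum K m i (n + 1)
    = z K (i.succPNat * m) * z K m ^ (n + 1) + z K m * insertSum K m i n := by
  rw [insertSum, Finset.sum_range_succ', insertSum, Finset.mul_sum, add_comm]
  simp [pow_succ', mul_assoc]

theorem insertSum_zero_left (m : ℕ+) (n : ℕ) :
    insertSum K m 0 n = ((n + 1 : ℕ) : K) • z K m ^ (n + 1) := by
  have h : ∀ j ∈ range (n + 1), z K m ^ j * z K ((0 : ℕ).succPNat * m) * z K m ^ (n - j)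
      = z K m ^ (n + 1) := by
    intro j hj
    have : (0 : ℕ).succPNat * m = m := one_mul m
    rw [this, ← pow_succ, ← pow_add]
    congr 1
    have := mem_range.1 hj
    omega
  rw [insertSum, Finset.sum_congr rfl h, Finset.sum_const, card_range, Nat.cast_smul_eq_nsmul]

/-- The letter z_{(i+1)m} is either inserted among the letters z_m or merged with one of them into
z_{(i+2)m}. -/
theorem stuffle_z_pow (m : ℕ+) (i n : ℕ) :
    stuffle K (z K (i.succPNat * m)) (z K m ^ (n + 1))
      = insertSum K m i (n + 1) + insertSum K m (i + 1) n := by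
  have hs : ∀ n : ℕ, stuffle K (z K (i.succPNat * m)) (z K m ^ (n + 1))
      = z K (i.succPNat * m) * z K m ^ (n + 1)
        + z K m * stuffle K (z K (i.succPNat * m)) (z K m ^ n)
        + z K ((i + 1).succPNat * m) * z K m ^ n := by
    intro n
    rw [pow_succ', ← zWord_replicate, stuffle_z_mul, z_succPNat_add_mul]
  induction n with
  | zero =>
    rw [hs, pow_zero, stuffle_one_right, insertSum_succ, insertSum_zero_right,
      insertSum_zero_right, mul_one]
  | succ n ih =>
    rw [hs, ih, insertSum_succ K m i (n + 1), insertSum_succ K m (i + 1) n, mul_add]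
    abel

/-- The merged words of each term cancel the inserted words of the next. The shift j is there for
the induction; j = 0 gives the Newton identity. -/
theorem sum_stuffle_z_pow (m : ℕ+) (j n : ℕ) :
    ∑ i ∈ range (n + 1), (-1 : K) ^ i • stuffle K (z K ((i + j).succPNat * m)) (z K m ^ (n - i))
      = insertSum K m j n := by
  induction n generalizing j with
  | zero => simp [stuffle_one_right, insertSum_zero_right]
  | succ n ih =>
    rw [Finset.sum_range_succ']
    have h := ih (j + 1)
    have e : ∀ i : ℕ, i + 1 + j = i + (j + 1) := fun i => by omega
    simp only [pow_succ, mul_neg_one, neg_smul, Finset.sum_neg_distrib, Nat.add_sub_add_right, e, h,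
      pow_zero, one_smul, zero_add, Nat.sub_zero]
    rw [← pow_succ, stuffle_z_pow]
    abel

/-- Since σ(z_m) = z_m + x^m, each non-final z_m is either kept or merged into its successor. So
S(z_m^n) grows by left multiplication with s = z_m + x^m. -/
theorem S_z_pow_succ (m : ℕ+) (n : ℕ) :
    S K (z K m ^ (n + 1)) = (z K m + X K ^ (m : ℕ)) ^ n * z K m := by
  have hz : sigma K (z K m) = z K m + X K ^ (m : ℕ) := by
    obtain ⟨k, hk⟩ : ∃ k, (m : ℕ) = k + 1 := ⟨_, (Nat.succ_pred_eq_of_pos m.pos).symm⟩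
    rw [z, hk]
    simp [sigma, X, Y, mul_add, pow_succ, add_comm]
  have h : z K m ^ (n + 1) = z K m ^ n * X K ^ ((m : ℕ) - 1) * FreeAlgebra.ι K Letter.y := by
    rw [pow_succ, mul_assoc]
    rfl
  rw [h, S_mul_letter, map_mul, map_pow, map_pow, hz, mul_assoc]
  simp [sigma, z, X, Y]

theorem word_mul_Y (u : List Letter) : ∃ k ks, word K u * Y K = z K k * zWord K ks := by
  induction u with
  | nil => exact ⟨1, [], by simp [z]⟩
  | cons a u ih =>
    obtain ⟨k, ks, h⟩ := ih
    cases a with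
    | x =>
      refine ⟨k + 1, ks, ?_⟩
      rw [word_cons, mul_assoc, h, ← X_pow_mul_z, mul_assoc]
      simp [X]
    | y =>
      refine ⟨1, k :: ks, ?_⟩
      rw [word_cons, mul_assoc, h]
      simp [z, Y]

/-- The stuffle product with `z_k` commutes with `z_m + x^m` up to an explicit term. -/
theorem stuffle_z_add_X_pow_mul (k m : ℕ+) (a : H K) :
    stuffle K (z K k) ((z K m + X K ^ (m : ℕ)) * (a * Y K))
      = z K k * ((z K m + X K ^ (m : ℕ)) * (a * Y K))
        + (z K m + X K ^ (m : ℕ)) * stuffle K (z K k) (a * Y K) := by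
  set s := z K m + X K ^ (m : ℕ) with hs
  have h : stuffle K (z K k) ∘ₗ LinearMap.mulLeft K s ∘ₗ LinearMap.mulRight K (Y K)
      = LinearMap.mulLeft K (z K k) ∘ₗ LinearMap.mulLeft K s ∘ₗ LinearMap.mulRight K (Y K)
        + LinearMap.mulLeft K s ∘ₗ stuffle K (z K k) ∘ₗ LinearMap.mulRight K (Y K) := by
    refine (wordBasis K).ext fun u => ?_
    obtain ⟨l, v, hv⟩ := word_mul_Y K u
    simp only [LinearMap.add_apply, LinearMap.comp_apply, LinearMap.mulLeft_apply,
      LinearMap.mulRight_apply, wordBasis_apply, hv, hs, add_mul, map_add]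
    have h1 : z K m * (z K l * zWord K v) = z K m * zWord K (l :: v) := by rw [zWord_cons]
    have h2 : ∀ (l : ℕ+) (w : H K), X K ^ (m : ℕ) * (z K l * w) = z K (l + m) * w := fun l w => by
      rw [← mul_assoc, X_pow_mul_z]
    -- For w = z_l v, the merging term z_{k+m} w of z_k * z_m w is the term x^m z_k w of x^m (z_k *
    -- w), which z_k * x^m w lacks. Hence the sum z_m + x^m has no correction term.
    rw [h1, stuffle_z_mul, zWord_cons, h2, stuffle_z_mul K k (l + m), stuffle_z_mul K k l,
      mul_add (X K ^ (m : ℕ)), mul_add (X K ^ (m : ℕ)), h2, h2, h2,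
      add_assoc k l m]
    abel
  exact LinearMap.congr_fun h a

/-- The sums of the words obtained from `z_m ⋯ z_m` by merging letters. -/
theorem sum_z_mul_S_z_pow (m : ℕ+) (n : ℕ) :
    ∑ i ∈ range (n + 1), z K (i.succPNat * m) * S K (z K m ^ (n - i)) = S K (z K m ^ (n + 1)) := by
  have h1 : (0 : ℕ).succPNat * m = m := one_mul m
  induction n with
  | zero => simpa [S_one, h1] using (S_z_pow_succ K m 0).symm
  | succ n ih =>
    rw [Finset.sum_range_succ']
    have h2 : ∀ i : ℕ, z K ((i + 1).succPNat * m) = X K ^ (m : ℕ) * z K (i.succPNat * m) :=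
      fun i => by rw [← z_succPNat_add_mul, X_pow_mul_z]
    simp only [h2, Nat.add_sub_add_right, mul_assoc]
    rw [← Finset.mul_sum, ih, h1, Nat.sub_zero, ← add_mul, S_z_pow_succ, S_z_pow_succ, pow_succ',
      mul_assoc, add_comm (X K ^ (m : ℕ))]

/-- By `hst`, each stuffle product splits into a concatenation and s times the product one step
shorter. The concatenations sum to S(z_m^{n+1}) by `sum_z_mul_S_z_pow`; the rest is s times the
previous case, so the multiplicity grows by one. -/
theorem sum_stuffle_z_S_z_pow (m : ℕ+) (n : ℕ) :
    ∑ i ∈ range (n + 1), stuffle K (z K (i.succPNat * m)) (S K (z K m ^ (n - i)))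
      = ((n + 1 : ℕ) : K) • S K (z K m ^ (n + 1)) := by
  set s := z K m + X K ^ (m : ℕ) with hs
  have h1 : (0 : ℕ).succPNat * m = m := one_mul m
  have hS : ∀ n, S K (z K m ^ (n + 1 + 1)) = s * S K (z K m ^ (n + 1)) := fun n => by
    rw [S_z_pow_succ, S_z_pow_succ, pow_succ', mul_assoc]
  have hst : ∀ i n : ℕ, stuffle K (z K (i.succPNat * m)) (S K (z K m ^ (n + 1)))
      = z K (i.succPNat * m) * S K (z K m ^ (n + 1))
        + s * stuffle K (z K (i.succPNat * m)) (S K (z K m ^ n)) := by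
    intro i n
    cases n with
    -- S(1) = 1 does not end in y, so the commutation rule does not apply and the product is
    -- computed directly.
    | zero =>
      rw [S_z_pow_succ, pow_zero, pow_zero, one_mul, S_one, stuffle_one_right, stuffle_z_z,
        hs, add_mul, X_pow_mul_z, add_assoc]
    | succ n =>
      have hY : S K (z K m ^ (n + 1)) = (s ^ n * X K ^ ((m : ℕ) - 1)) * Y K := by
        rw [S_z_pow_succ, mul_assoc]
        rfl
      rw [hS, hY, stuffle_z_add_X_pow_mul]
  induction n with
  | zero => simpa [S_one, stuffle_one_right, h1] using (S_z_pow_succ K m 0).symm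
  | succ n ih =>
    have h2 : ∀ i ∈ range (n + 1), stuffle K (z K (i.succPNat * m)) (S K (z K m ^ (n + 1 - i)))
        = z K (i.succPNat * m) * S K (z K m ^ (n + 1 - i))
          + s * stuffle K (z K (i.succPNat * m)) (S K (z K m ^ (n - i))) := by
      intro i hi
      rw [show n + 1 - i = n - i + 1 by have := mem_range.1 hi; omega, hst]
    have h3 := sum_z_mul_S_z_pow K m (n + 1)
    rw [Finset.sum_range_succ] at h3 ⊢
    rw [Finset.sum_congr rfl h2, Finset.sum_add_distrib, ← Finset.mul_sum, ih, mul_smul_comm, ← hS]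
    simp only [Nat.sub_self, pow_zero, S_one, stuffle_one_right, mul_one] at h3 ⊢
    rw [add_right_comm, h3, Nat.cast_succ (n + 1), add_smul, one_smul, add_comm]

end Newton

/-! ### Newton recursions for the zeta values and comparison with the constants -/

section Zeta

variable {K : Type*} [Field K] {R : Type*} [CommRing R] [Algebra K R]
  {Z : h0 K →ₗ[K] R} {E : H K →ₗ[K] R}

theorem z_pow_mem_h0 {m : ℕ+} (hm : 2 ≤ m) (n : ℕ) : z K m ^ n ∈ h0 K := by
  rw [← zWord_replicate]
  exact zWord_mem_h0 (admissible_replicate n hm)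

theorem z_mul_mem_h0_of_two_le {m : ℕ+} (hm : 2 ≤ m) (l : ℕ+) : z K (l * m) ∈ h0 K :=
  z_mem_h0 K _ (hm.trans (le_mul_of_one_le_left' one_le))

theorem IsExtension.zetaRep_eq (hE : IsExtension Z E) (m : ℕ+) (hm : 2 ≤ m) (n : ℕ) :
    zetaRep Z m hm n = E (z K m ^ n) := by
  rw [zetaRep, zeta, hE.apply_mk, zWord_replicate]

theorem IsExtension.zetaStarRep_eq (hE : IsExtension Z E) (m : ℕ+) (hm : 2 ≤ m) (n : ℕ) :
    zetaStarRep Z m hm n = E (S K (z K m ^ n)) := by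
  rw [zetaStarRep, zetaStar, LinearMap.comp_apply, ← zWord_replicate]
  exact hE.apply_mk _ _

theorem IsExtension.zeta_newton (hE : IsExtension Z E) (hZ : RegularizedDoubleShuffle Z)
    {m : ℕ+} (hm : 2 ≤ m) (n : ℕ) :
    ((n + 1 : ℕ) : R) * E (z K m ^ (n + 1))
      = ∑ i ∈ range (n + 1), (-1 : K) ^ i • E (z K (i.succPNat * m)) * E (z K m ^ (n - i)) := by
  have h := congrArg E (sum_stuffle_z_pow K m 0 n)
  rw [insertSum_zero_left, map_sum, map_smul, Algebra.smul_def, map_natCast] at h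
  rw [← h]
  refine Finset.sum_congr rfl fun i _ => ?_
  rw [map_smul, add_zero, hE.map_stuffle hZ (z_mul_mem_h0_of_two_le hm _) (z_pow_mem_h0 hm _),
    smul_mul_assoc]

theorem IsExtension.zetaStar_newton (hE : IsExtension Z E) (hZ : RegularizedDoubleShuffle Z)
    {m : ℕ+} (hm : 2 ≤ m) (n : ℕ) :
    ((n + 1 : ℕ) : R) * E (S K (z K m ^ (n + 1)))
      = ∑ i ∈ range (n + 1), E (z K (i.succPNat * m)) * E (S K (z K m ^ (n - i))) := by
  have h := congrArg E (sum_stuffle_z_S_z_pow K m n)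
  rw [map_sum, map_smul, Algebra.smul_def, map_natCast] at h
  rw [← h]
  refine Finset.sum_congr rfl fun i _ => ?_
  rw [hE.map_stuffle hZ (z_mul_mem_h0_of_two_le hm _) (S_mem_h0 K (z_pow_mem_h0 hm _))]

variable [CharZero K]

theorem IsExtension.map_z_mul_two_mul (hE : IsExtension Z E) (hZ : RegularizedDoubleShuffle Z)
    (k : ℕ+) (i : ℕ) :
    E (z K (i.succPNat * (2 * k)))
      = (MZVSeries.evenZetaCoeff (k * (i + 1)) : K) • ((-6 * E (z K 2)) ^ (k : ℕ)) ^ (i + 1) := by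
  obtain ⟨q, hq⟩ : ∃ q, (k : ℕ) * (i + 1) = q + 1 :=
    ⟨_, (Nat.succ_pred_eq_of_pos (Nat.mul_pos k.pos i.succ_pos)).symm⟩
  have h := hE.map_z_even hZ q
  rw [← pow_mul, hq, ← h]
  congr 2
  apply PNat.coe_injective
  simp only [PNat.mul_coe, Nat.succPNat_coe, PNat.val_ofNat, Nat.succ_eq_add_one]
  linear_combination 2 * hq

theorem exists_rat_zetaRep (hZ : RegularizedDoubleShuffle Z) (k : ℕ+) (n : ℕ) :
    ∃ c : ℚ, (c : ℂ) = coeff k n ∧ zetaRep Z (2 * k) (two_le_two_mul k) n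
      = (c : K) • (-6 * zetaRep Z 2 le_rfl 1) ^ (n * (k : ℕ)) := by
  obtain ⟨E, hE⟩ := exists_isExtension Z
  obtain ⟨c, hc, hc0, hcn⟩ := MZVSeries.exists_rat_of_newton
    (fun i => (-1) ^ (i + 1) * MZVSeries.evenZetaCoeff (k * i)) (coeff k)
    (MZVSeries.coeff_zero_right k) (MZVSeries.coeff_newton k)
  refine ⟨c n, hc n, ?_⟩
  rw [hE.zetaRep_eq, hE.zetaRep_eq, pow_one, mul_comm n, pow_mul]
  refine MZVSeries.eq_smul_pow_of_newton
    (p := fun i => (-1) ^ (i + 1) * MZVSeries.evenZetaCoeff (k * i))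
    -- Power sums are indexed from 1, so P is used only at i + 1, and the truncated value at i = 0
    -- is irrelevant.
    (P := fun i => (-1 : K) ^ (i - 1) • E (z K ((i - 1).succPNat * (2 * k))))
    (e := fun n => E (z K (2 * k) ^ n)) hc0 hcn ?_ ?_ ?_ n
  · simp [hE.map_one hZ]
  · exact fun n => hE.zeta_newton hZ (two_le_two_mul k) n
  · intro i
    simp only [Nat.add_sub_cancel]
    rw [hE.map_z_mul_two_mul hZ, smul_smul]
    congr 1
    push_cast
    ring

theorem exists_rat_zetaStarRep (hZ : RegularizedDoubleShuffle Z) (k : ℕ+) (n : ℕ) :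
    ∃ c : ℚ, (c : ℂ) = coeffStar k n ∧ zetaStarRep Z (2 * k) (two_le_two_mul k) n
      = (c : K) • (-6 * zetaRep Z 2 le_rfl 1) ^ (n * (k : ℕ)) := by
  obtain ⟨E, hE⟩ := exists_isExtension Z
  obtain ⟨c, hc, hc0, hcn⟩ := MZVSeries.exists_rat_of_newton
    (fun i => MZVSeries.evenZetaCoeff (k * i)) (coeffStar k)
    (MZVSeries.coeffStar_zero_right k) (MZVSeries.coeffStar_newton k)
  refine ⟨c n, hc n, ?_⟩
  rw [hE.zetaStarRep_eq, hE.zetaRep_eq, pow_one, mul_comm n, pow_mul]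
  refine MZVSeries.eq_smul_pow_of_newton
    (p := fun i => MZVSeries.evenZetaCoeff (k * i))
    (P := fun i => E (z K ((i - 1).succPNat * (2 * k))))
    (e := fun n => E (S K (z K (2 * k) ^ n))) hc0 hcn ?_ ?_ ?_ n
  · simp [S_one, hE.map_one hZ]
  · exact fun n => hE.zetaStar_newton hZ (two_le_two_mul k) n
  · exact fun i => hE.map_z_mul_two_mul hZ k i

end Zeta

theorem algebraMap_smul_pow {K R L : Type*} [Field K] [CharZero K] [CommRing R] [Algebra K R]
    [CommRing L] [Algebra K L] [Algebra R L] [IsScalarTower K R L] {ζ : R} {lam : L}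
    (hlam : lam ^ 2 = algebraMap R L (-24 * ζ)) (c : K) (n k : ℕ) :
    algebraMap R L (c • (-6 * ζ) ^ (n * k)) = (c / 4 ^ (n * k)) • lam ^ (2 * n * k) := by
  have h4 : (4 : K) ^ (n * k) ≠ 0 := pow_ne_zero _ (by norm_num)
  -- λ² = 4τ accounts for the denominator 4^{nk}.
  have h : lam ^ 2 = (4 : K) • algebraMap R L (-6 * ζ) := by
    rw [hlam, Algebra.smul_def, map_ofNat, show -24 * ζ = 4 * (-6 * ζ) by ring, map_mul, map_ofNat]
  rw [mul_assoc 2 n k, pow_mul lam, h, smul_pow, smul_smul, div_mul_cancel₀ _ h4, ← map_pow,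
    Algebra.smul_def c ((algebraMap R L) _), IsScalarTower.algebraMap_apply K R L, ← map_mul,
    ← Algebra.smul_def]

end MZV

theorem mainTheorem7 {K R L : Type*} [Field K] [CharZero K] [CommRing R] [Algebra K R]
    [CommRing L] [Algebra K L] [Algebra R L] [IsScalarTower K R L]
    (Z : MZV.h0 K →ₗ[K] R) (hZ : MZV.RegularizedDoubleShuffle Z)
    (lam : L) (hlam : lam ^ 2 = algebraMap R L (-24 * MZV.zetaRep Z 2 le_rfl 1)) :
    (∀ (k : ℕ+) (n : ℕ),
      (∃ c : ℚ, (c : ℂ) = MZV.coeff k n ∧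
        algebraMap R L (MZV.zetaRep Z (2 * k) (MZV.two_le_two_mul k) n)
          = ((c : K) / 4 ^ (n * (k : ℕ))) • lam ^ (2 * n * (k : ℕ))) ∧
      (∃ c : ℚ, (c : ℂ) = MZV.coeffStar k n ∧
        algebraMap R L (MZV.zetaStarRep Z (2 * k) (MZV.two_le_two_mul k) n)
          = ((c : K) / 4 ^ (n * (k : ℕ))) • lam ^ (2 * n * (k : ℕ)))) ∧
    ∀ n : ℕ, algebraMap R L (MZV.zetaRep Z 4 (by decide) n)
      = (2 / (4 ^ n * ((4 * n + 2).factorial : K))) • lam ^ (4 * n) := by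
  refine ⟨fun k n => ⟨?_, ?_⟩, fun n => ?_⟩
  · obtain ⟨c, hc, h⟩ := MZV.exists_rat_zetaRep hZ k n
    exact ⟨c, hc, by rw [h, MZV.algebraMap_smul_pow hlam]⟩
  · obtain ⟨c, hc, h⟩ := MZV.exists_rat_zetaStarRep hZ k n
    exact ⟨c, hc, by rw [h, MZV.algebraMap_smul_pow hlam]⟩
  · obtain ⟨c, hc, h⟩ := MZV.exists_rat_zetaRep hZ 2 n
    have hc' : c = 2 * 4 ^ n / ((4 * n + 2).factorial : ℚ) := by
      rw [MZVSeries.coeff_two] at hc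
      apply Rat.cast_injective (α := ℂ)
      rw [hc]
      push_cast
      rfl
    have h4 : MZV.zetaRep Z 4 (by decide) n = MZV.zetaRep Z (2 * 2) (MZV.two_le_two_mul 2) n := rfl
    rw [h4, h, MZV.algebraMap_smul_pow hlam, hc']
    have h0 : (4 : K) ≠ 0 := by norm_num
    congr 1
    -- Of the denominator 4^{2n}, one factor 4^n cancels against the numerator of c_{2,n}.
    · rw [show n * ((2 : ℕ+) : ℕ) = n + n by simp [mul_two], pow_add]
      push_cast
      field_simp
    · congr 1
      simp
      ring
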